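/- Let $\alpha,\beta,\gamma_1,\gamma_2\in\mathbb{C}^\times$ be the exponentials $\alpha=e^{2\pi i a}$, $\beta=e^{2\pi i b}$, $\gamma_k=e^{2\pi i c_k}$ of the parameters of Appell's hypergeometric system $F_4(a,b,c_1,c_2)$. Put $$M_1=\begin{pmatrix}1&-\gamma_1^{-1}&0&0\\0&\gamma_1^{-1}&0&0\\0&0&1&-\gamma_1^{-1}\\0&0&0&\gamma_1^{-1}\end{pmatrix},\qquad M_2=\begin{pmatrix}1&0&-\gamma_2^{-1}&0\\0&1&0&-\gamma_2^{-1}\\0&0&\gamma_2^{-1}&0\\0&0&0&\gamma_2^{-1}\end{pmatrix},$$ $$M_0=\begin{pmatrix}1&0&0&0\\0&1&0&0\\0&0&1&0\\-\frac{(\alpha-1)(\beta-1)\gamma_1\gamma_2}{\alpha\beta}&\frac{(\alpha\beta-\gamma_1)\gamma_2}{\alpha\beta}&\frac{(\alpha\beta-\gamma_2)\gamma_1}{\alpha\beta}&-\frac{\gamma_1\gamma_2}{\alpha\beta}\end{pmatrix},$$ let $\mathbf{Mon}^{(2)}=\langle M_0,M_1,M_2\rangle\subset GL_4(\mathbb{C})$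 be the monodromy group, let $\mathbf{Ref}^{(2)}$ be the smallest normal subgroup of $\mathbf{Mon}^{(2)}$ containing $M_0$, i.e. the subgroup generated by all $gM_0g^{-1}$ with $g\in\mathbf{Mon}^{(2)}$, and let $\delta_0^{(2)}=-\gamma_1\gamma_2\alpha^{-1}\beta^{-1}$, the special eigenvalue of the reflection $M_0$. Let $E_4$ be the identity matrix. Assume that $\mathbf{Mon}^{(2)}$ is finite and acts irreducibly on $\mathbb{C}^4$, that $\delta_0^{(2)}=-1$ (i.e. $\gamma_1\gamma_2\alpha^{-1}\beta^{-1}=1$), and that $\gamma_1\neq-1$. Then: 1. If $\gamma_2=-1$ and $\beta\alpha^{-1}\neq-1$, then $\mathbf{Ref}^{(2)}\cap\langle M_1,M_2\rangle=\{E_4\}$. 2. If $\beta\alpha^{-1}=-1$ and $\gamma_2\neq-1$, then $\gamma_k$ is a primitive $q_k$-th root of unity with $q_k\in\{3,4,5\}$ ($k=1,2$), and: - if $q_1\neq q_2$, then $\mathbf{Ref}^{(2)}\cap\langle M_1,M_2\rangle=\{E_4\}$; - if $q_1=q_2=3$ and $\gamma_2=\gamma_1$, then $\mathbf{Ref}^{(2)}\cap\langle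 M_1,M_2\rangle=\{E_4\}$; - if $q_1=q_2=3$ and $\gamma_2=\gamma_1^2$, then $\mathbf{Ref}^{(2)}\cap\langle M_1,M_2\rangle=\langle M_1M_2\rangle\simeq\mathbb{Z}/3\mathbb{Z}$; - if $q_1=q_2=5$, then an integer $j$ with $\gamma_1\gamma_2^{\,j}=1$ exists, and for every such $j$, $\mathbf{Ref}^{(2)}\cap\langle M_1,M_2\rangle=\langle M_1M_2^{\,j}\rangle\simeq\mathbb{Z}/5\mathbb{Z}$. -/

import Mathlib

/-! Monodromy and reflection groups of Appell's hypergeometric system `F₄`, with parameters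
`α = exp (2πi a)`, `β = exp (2πi b)`, `γₖ = exp (2πi cₖ)`, i.e. arbitrary nonzero complex numbers.
The basis of `ℂ⁴ = ℂ² ⊗ ℂ²` is ordered as `e₀₀, e₁₀, e₀₁, e₁₁`. -/

namespace AppellF4

/-- The matrix `G(γ₁) ⊗ E₂`, where `G(γ) = !![1, -γ⁻¹; 0, γ⁻¹]`. -/
noncomputable def mat1 (γ₁ : ℂˣ) : Matrix (Fin 4) (Fin 4) ℂ :=
  !![1, -(γ₁ : ℂ)⁻¹, 0, 0;
     0, (γ₁ : ℂ)⁻¹, 0, 0;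
     0, 0, 1, -(γ₁ : ℂ)⁻¹;
     0, 0, 0, (γ₁ : ℂ)⁻¹]

/-- The matrix `E₂ ⊗ G(γ₂)`, where `G(γ) = !![1, -γ⁻¹; 0, γ⁻¹]`. -/
noncomputable def mat2 (γ₂ : ℂˣ) : Matrix (Fin 4) (Fin 4) ℂ :=
  !![1, 0, -(γ₂ : ℂ)⁻¹, 0;
     0, 1, 0, -(γ₂ : ℂ)⁻¹;
     0, 0, (γ₂ : ℂ)⁻¹, 0;
     0, 0, 0, (γ₂ : ℂ)⁻¹]

/-- The matrix of the circuit transformation around the non-coordinate component of the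
singular locus. -/
noncomputable def mat0 (α β γ₁ γ₂ : ℂˣ) : Matrix (Fin 4) (Fin 4) ℂ :=
  !![1, 0, 0, 0;
     0, 1, 0, 0;
     0, 0, 1, 0;
     -(((α : ℂ) - 1) * ((β : ℂ) - 1) * γ₁ * γ₂ / (α * β)),
       ((α : ℂ) * β - γ₁) * γ₂ / (α * β),
       ((α : ℂ) * β - γ₂) * γ₁ / (α * β),
       -((γ₁ : ℂ) * γ₂ / (α * β))]

theorem det_mat1_ne_zero (γ₁ : ℂˣ) : (mat1 γ₁).det ≠ 0 := by
  have h : (γ₁ : ℂ) ≠ 0 := γ₁.ne_zero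
  simp [mat1, Matrix.det_succ_row_zero, Fin.sum_univ_succ, Fin.succAbove, h]

theorem det_mat2_ne_zero (γ₂ : ℂˣ) : (mat2 γ₂).det ≠ 0 := by
  have h : (γ₂ : ℂ) ≠ 0 := γ₂.ne_zero
  simp [mat2, Matrix.det_succ_row_zero, Fin.sum_univ_succ, Fin.succAbove, h]

theorem det_mat0_ne_zero (α β γ₁ γ₂ : ℂˣ) : (mat0 α β γ₁ γ₂).det ≠ 0 := by
  simp [mat0, Matrix.det_succ_row_zero, Fin.sum_univ_succ, Fin.succAbove]

/-- `M₁ ∈ GL₄(ℂ)`. -/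
noncomputable def M1 (γ₁ : ℂˣ) : Matrix.GeneralLinearGroup (Fin 4) ℂ :=
  Matrix.GeneralLinearGroup.mkOfDetNeZero (mat1 γ₁) (det_mat1_ne_zero γ₁)

/-- `M₂ ∈ GL₄(ℂ)`. -/
noncomputable def M2 (γ₂ : ℂˣ) : Matrix.GeneralLinearGroup (Fin 4) ℂ :=
  Matrix.GeneralLinearGroup.mkOfDetNeZero (mat2 γ₂) (det_mat2_ne_zero γ₂)

/-- `M₀ ∈ GL₄(ℂ)`. -/
noncomputable def M0 (α β γ₁ γ₂ : ℂˣ) : Matrix.GeneralLinearGroup (Fin 4) ℂ :=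
  Matrix.GeneralLinearGroup.mkOfDetNeZero (mat0 α β γ₁ γ₂) (det_mat0_ne_zero α β γ₁ γ₂)

/-- The special eigenvalue `δ₀ = -γ₁γ₂/(αβ)` of the reflection `M₀`. -/
noncomputable def delta0 (α β γ₁ γ₂ : ℂˣ) : ℂˣ := -(γ₁ * γ₂ * α⁻¹ * β⁻¹)

/-- The monodromy group `⟨M₀, M₁, M₂⟩`. -/
noncomputable def Mon (α β γ₁ γ₂ : ℂˣ) : Subgroup (Matrix.GeneralLinearGroup (Fin 4) ℂ) :=
  Subgroup.closure {M0 α β γ₁ γ₂, M1 γ₁, M2 γ₂}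

/-- The reflection subgroup: the normal closure of `M₀` in the monodromy group, i.e. the subgroup
generated by the reflections `g M₀ g⁻¹`, where `g` runs through the monodromy group. -/
noncomputable def Ref (α β γ₁ γ₂ : ℂˣ) : Subgroup (Matrix.GeneralLinearGroup (Fin 4) ℂ) :=
  Subgroup.closure {x | ∃ g ∈ Mon α β γ₁ γ₂, x = g * M0 α β γ₁ γ₂ * g⁻¹}

/-- The subgroup `⟨M₁, M₂⟩`. -/
noncomputable def Loc (γ₁ γ₂ : ℂˣ) : Subgroup (Matrix.GeneralLinearGroup (Fin 4) ℂ) :=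
  Subgroup.closure {M1 γ₁, M2 γ₂}

/-- The tautological representation on `ℂ⁴` of a subgroup of `GL₄(ℂ)`. -/
noncomputable def tautRep (G : Subgroup (Matrix.GeneralLinearGroup (Fin 4) ℂ)) :
    Representation ℂ G (Fin 4 → ℂ) :=
  (Matrix.toLinAlgEquiv' : Matrix (Fin 4) (Fin 4) ℂ ≃ₐ[ℂ] _).toMulEquiv.toMonoidHom.comp
    ((Units.coeHom (Matrix (Fin 4) (Fin 4) ℂ)).comp G.subtype)

/-- A subgroup of `GL₄(ℂ)` is finite irreducible if it is finite and acts irreducibly on `ℂ⁴`. -/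
def FiniteIrreducible (G : Subgroup (Matrix.GeneralLinearGroup (Fin 4) ℂ)) : Prop :=
  Finite G ∧ (tautRep G).IsIrreducible

end AppellF4

/-! The condition δ₀ = -1 says γ₁γ₂ = αβ, and then the problem drops to rank two. Put u = γ₁⁻¹, v =
γ₂⁻¹, let A = `reflA u` and B = `reflB v y`, with y chosen so that AB has eigenvalues α⁻¹ and β⁻¹,
and let Γ = ⟨A, B⟩. Irreducibility identifies ℂ⁴ with M₂(ℂ) (`toMatEquiv`). There M₁ is left
multiplication by A, M₂ is right multiplication by adj(B), and M₀ is X ↦ -adj(X), the reflection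
that negates 1 and fixes the traceless matrices. Conjugation by M₀ swaps the two factors of Γ × Γ.
Modulo [Γ, Γ], the product xy is therefore an invariant separating the elements of Ref among the
maps X ↦ xX adj(y), which gives the key equivalence `M1_zpow_mul_M2_zpow_mem_Ref_iff`: M₁ⁱM₂ʲ ∈ Ref
exactly when AⁱBʲ ∈ [Γ, Γ].

Determinants give the necessary condition γ₁ⁱγ₂ʲ = 1. What remains is to decide which such pairs
really occur. Γ is finite and A, B have no common eigenvector, so counting orbits on the projective
line (`MulAction.exists_fixed_or_pow_mem`) bounds the orders modulo scalars by 5 once two suitable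
elements have order at least 3. This restricts the γₖ, and through tr²/det (`pow_mem_center_discr`)
also the position of A relative to B.

Coprime orders make the intersection trivial at once. The other trivial cases come from reduction at
a prime above 2: for γ₁ of order 4 and γ₂ = -1 the reduced group lies in GL₂(𝔽₂) ≅ S₃ and the sign
is an obstruction (`even_add_of_order_four`); for γ₁ = γ₂ of order 3 the reduced matrices acquire a
common eigenvector (`zpow_eq_one_of_primitive_cube_root`). The nontrivial intersections come from
braid relations, which make A conjugate in Γ to B⁻ʲ, so that ABʲ is a commutator. -/

/-! ### Orbit counting for actions with two fixed points per element -/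

open MulAction in
-- Burnside's lemma, with elements of `Z` fixing everything and all others fixing two points.
-- Divided by |G|, each summand becomes 1 - 1/e, where e is the order of a point stabilizer modulo
-- `Z`.
theorem MulAction.sum_orbits_card_sub {G X : Type*} [Group G] [Finite G] [Finite X]
    [MulAction G X] (Z : Subgroup G) (hZ : ∀ z ∈ Z, ∀ x : X, z • x = x)
    (h2 : ∀ g ∉ Z, Nat.card (fixedBy X g) = 2) [Fintype (orbitRel.Quotient G X)] :
    ∑ ω : orbitRel.Quotient G X,
      ((Nat.card G : ℚ) - Nat.card Z * Nat.card (orbit G ω.out)) =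
      2 * (Nat.card G - Nat.card Z) := by
  classical
  have := Fintype.ofFinite G
  have := Fintype.ofFinite X
  have hb := sum_card_fixedBy_eq_card_orbits_mul_card_group G X
  have hX : Nat.card X = ∑ ω : orbitRel.Quotient G X, Nat.card (orbit G ω.out) := by
    rw [Nat.card_congr (selfEquivSigmaOrbits G X), Nat.card_sigma]
  have hs : ∑ g : G, (Fintype.card (fixedBy X g) : ℚ) =
      Nat.card Z * Nat.card X + 2 * (Nat.card G - Nat.card Z) := by
    have h : ∀ g : G, (Fintype.card (fixedBy X g) : ℚ) =
        2 + if g ∈ Z then (Nat.card X - 2 : ℚ) else 0 := by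
      intro g
      rw [← Nat.card_eq_fintype_card]
      split_ifs with hg
      · have : fixedBy X g = Set.univ := Set.eq_univ_of_forall (hZ g hg)
        rw [this, Nat.card_coe_set_eq, Set.ncard_univ]; ring
      · rw [h2 g hg]; norm_num
    rw [Finset.sum_congr rfl fun g _ => h g, Finset.sum_add_distrib, ← Finset.sum_filter,
      Finset.sum_const, Finset.sum_const, Finset.card_univ]
    have hc : (Finset.univ.filter fun g : G => g ∈ Z).card = Nat.card Z := by
      rw [Nat.card_eq_fintype_card, Fintype.card_subtype]
    rw [hc, Nat.card_eq_fintype_card (α := G)]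
    simp only [nsmul_eq_mul]
    ring
  rw [Finset.sum_sub_distrib, ← Finset.mul_sum]
  have hb' : ∑ g : G, (Fintype.card (fixedBy X g) : ℚ) =
      Fintype.card (orbitRel.Quotient G X) * Nat.card G := by
    rw [Nat.card_eq_fintype_card]; exact_mod_cast hb
  rw [Finset.sum_const, Finset.card_univ, nsmul_eq_mul, ← hb', hs, hX]
  push_cast
  ring

/-- If `∑ (1 - 1/e_i) = 2 - 2/n` with `2 ≤ e_i ≤ n` and `6 ≤ e_q`, then `e_q = n`, or
`2 e_q = n` and the remaining `e_i` are equal to `2`. -/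
theorem eq_or_of_sum_one_sub_inv {ι : Type*} [Fintype ι] (e : ι → ℕ) (n : ℕ)
    (he : ∀ i, 2 ≤ e i) (hn : ∀ i, e i ≤ n)
    (hsum : ∑ i, (1 - 1 / (e i : ℚ)) = 2 - 2 / n) (q : ι) (hq : 6 ≤ e q) :
    e q = n ∨ (2 * e q = n ∧ ∀ i ≠ q, e i = 2) := by
  classical
  have hnpos : (0 : ℚ) < n := by
    have := hn q
    exact_mod_cast (by omega : 0 < n)
  have hpos : ∀ i, (0 : ℚ) < e i := fun i => by
    have := he i
    exact_mod_cast (by omega : 0 < e i)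
  have hhalf : ∀ i, (1 / 2 : ℚ) ≤ 1 - 1 / (e i : ℚ) := fun i => by
    have h2 : (2 : ℚ) ≤ e i := by exact_mod_cast he i
    have := one_div_le_one_div_of_le (by norm_num) h2
    linarith
  have hge : ∀ i, (1 : ℚ) / n ≤ 1 / e i := fun i =>
    one_div_le_one_div_of_le (hpos i) (by exact_mod_cast hn i)
  have hq6 : (1 : ℚ) / e q ≤ 1 / 6 :=
    one_div_le_one_div_of_le (by norm_num) (by exact_mod_cast hq)
  have h2n : (2 : ℚ) / n = 2 * (1 / n) := by ring
  have hn0 : (0 : ℚ) < 1 / n := by positivity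
  rw [← Finset.add_sum_erase _ _ (Finset.mem_univ q), h2n] at hsum
  -- The term of `q` is at least 5/6 and every other term at least 1/2, so three others would exceed
  -- 2.
  have hcard : (Finset.univ.erase q).card ≤ 2 := by
    by_contra! hc
    have h := Finset.card_nsmul_le_sum (Finset.univ.erase q) (fun i => 1 - 1 / (e i : ℚ)) (1 / 2)
      (fun i _ => hhalf i)
    rw [nsmul_eq_mul] at h
    have h3 : (3 : ℚ) ≤ (Finset.univ.erase q).card := by exact_mod_cast hc
    linarith
  have hinv : ∀ i, (1 : ℚ) / e i = 1 / n → e i = n := fun i h => by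
    have : (e i : ℚ) = n := by simpa using h
    exact_mod_cast this
  interval_cases hk : (Finset.univ.erase q).card
  · rw [Finset.card_eq_zero] at hk
    rw [hk, Finset.sum_empty] at hsum
    have := hge q
    linarith
  · obtain ⟨i, hi⟩ := Finset.card_eq_one.1 hk
    rw [hi, Finset.sum_singleton] at hsum
    left
    apply hinv
    linarith [hge q, hge i]
  · obtain ⟨i, j, hij, h⟩ := Finset.card_eq_two.1 hk
    rw [h, Finset.sum_pair hij] at hsum
    -- If `e i` were at least 3, the three terms would sum to at least 5/6 + 2/3 + 1/2 = 2.
    have key : ∀ i j : ι, 1 - 1 / (e q : ℚ) + (1 - 1 / (e i : ℚ) + (1 - 1 / (e j : ℚ))) =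
        2 - 2 * (1 / n) → e i = 2 := by
      intro i j hs
      by_contra h2
      have h3 : (3 : ℚ) ≤ e i := by
        have := he i
        exact_mod_cast (by omega : 3 ≤ e i)
      have := one_div_le_one_div_of_le (by norm_num) h3
      linarith [hhalf j]
    have hi2 := key i j hsum
    have hj2 := key j i (by linarith)
    right
    constructor
    · rw [hi2, hj2] at hsum
      have h1 : (1 : ℚ) / e q = 2 * (1 / n) := by
        push_cast at hsum
        linarith
      have := hpos q
      field_simp at h1
      have h2 : (n : ℚ) = e q * 2 := h1
      rw [mul_comm]
      exact_mod_cast h2.symm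
    · intro k hkq
      have : k ∈ Finset.univ.erase q := by simp [hkq]
      rw [h] at this
      simp only [Finset.mem_insert, Finset.mem_singleton] at this
      rcases this with rfl | rfl <;> assumption

open MulAction in
/-- Let a finite group `G` act on a finite set so that the elements outside of a normal subgroup
`Z` have exactly two fixed points. Then the orders of all elements modulo `Z` are at most `5`,
unless the elements of order at least `3` modulo `Z` have a common fixed point. -/
theorem MulAction.exists_fixed_or_pow_mem {G X : Type*} [Group G] [Finite G] [Finite X]
    [MulAction G X] (Z : Subgroup G) [Z.Normal] (hZ : ∀ z ∈ Z, ∀ x : X, z • x = x)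
    (h2 : ∀ g ∉ Z, Nat.card (fixedBy X g) = 2) (hX : ∀ x : X, ∃ g ∉ Z, g • x = x) :
    (∃ x : X, ∀ g : G, g ^ 2 ∉ Z → g • x = x) ∨ ∀ g : G, ∃ e, 1 ≤ e ∧ e ≤ 5 ∧ g ^ e ∈ Z := by
  classical
  rw [or_iff_not_imp_right]
  intro hg
  push Not at hg
  obtain ⟨g₀, hg₀⟩ := hg
  have := Fintype.ofFinite (orbitRel.Quotient G X)
  have hle : ∀ x : X, Z ≤ stabilizer G x := fun x z hz => hZ z hz x
  set e : X → ℕ := fun x => Z.relIndex (stabilizer G x) with he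
  have hemul : ∀ x, Nat.card Z * e x = Nat.card (stabilizer G x) := fun x => by
    rw [← Nat.card_congr (Subgroup.subgroupOfEquivOfLe (hle x)).toEquiv]
    exact Subgroup.card_mul_index _
  have hpow : ∀ x : X, ∀ g : G, g • x = x → g ^ e x ∈ Z := by
    intro x g hgx
    have : (⟨g, hgx⟩ : stabilizer G x) ^ (Z.subgroupOf (stabilizer G x)).index ∈
      Z.subgroupOf (stabilizer G x) := Subgroup.pow_index_mem _ _
    exact this
  have hZpos : 0 < Nat.card Z := Nat.card_pos
  have hepos : ∀ x, 0 < e x := fun x => by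
    have h1 : 0 < Nat.card (stabilizer G x) := Nat.card_pos
    rw [← hemul x] at h1
    exact Nat.pos_of_mul_pos_left h1 
  have he2 : ∀ x, 2 ≤ e x := by
    intro x
    obtain ⟨g, hg, hgx⟩ := hX x
    by_contra! h
    have h1 : e x = 1 := by have := hepos x; omega
    have := hpow x g hgx
    rw [h1, pow_one] at this
    exact hg this
  have horb : ∀ x : X, Nat.card (orbit G x) * Nat.card (stabilizer G x) = Nat.card G := by
    intro x
    rw [Nat.card_congr (orbitEquivQuotientStabilizer G x)]
    exact (Subgroup.card_eq_card_quotient_mul_card_subgroup _).symm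
  have hGZ : Nat.card Z * Z.index = Nat.card G := Subgroup.card_mul_index Z
  have hoe : ∀ x : X, Nat.card (orbit G x) * e x = Z.index := by
    intro x
    have h1 := horb x
    rw [← hemul x, ← hGZ] at h1
    exact Nat.eq_of_mul_eq_mul_left hZpos (by linarith)
  have hen : ∀ x : X, e x ≤ Z.index := fun x => by
    rw [← hoe x]
    have : 0 < Nat.card (orbit G x) := by
      have : Nonempty (orbit G x) := ⟨⟨x, mem_orbit_self x⟩⟩
      exact Nat.card_pos
    exact Nat.le_mul_of_pos_left _ this
  have hsum : ∑ ω : orbitRel.Quotient G X, (1 - 1 / (e ω.out : ℚ)) = 2 - 2 / Z.index := by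
    have hs := MulAction.sum_orbits_card_sub (X := X) Z hZ h2
    have hZ0 : (Nat.card Z : ℚ) ≠ 0 := by exact_mod_cast hZpos.ne'
    have hi0 : (Z.index : ℚ) ≠ 0 := by exact_mod_cast Subgroup.index_ne_zero_of_finite
    have hG : (Nat.card G : ℚ) = Nat.card Z * Z.index := by exact_mod_cast hGZ.symm
    have ht : ∀ ω : orbitRel.Quotient G X, (1 - 1 / (e ω.out : ℚ)) =
        ((Nat.card G : ℚ) - Nat.card Z * Nat.card (orbit G ω.out)) / Nat.card G := by
      intro ω
      have hx : (Nat.card (orbit G ω.out) : ℚ) * e ω.out = Z.index := by exact_mod_cast hoe ω.out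
      have h0 : (e ω.out : ℚ) ≠ 0 := by exact_mod_cast (hepos ω.out).ne'
      rw [hG]
      field_simp
      linear_combination hx
    rw [Finset.sum_congr rfl fun ω _ => ht ω, ← Finset.sum_div, hs, hG]
    field_simp
  have hfix : ∀ g : G, g ∉ Z → ∃ x : X, g • x = x := by
    intro g hg
    have h := h2 g hg
    have : Nonempty (fixedBy X g) := by
      by_contra hne
      rw [not_nonempty_iff] at hne
      rw [Nat.card_of_isEmpty] at h
      omega
    obtain ⟨x, hx⟩ := this
    exact ⟨x, hx⟩
  have hg₀Z : g₀ ∉ Z := by simpa using hg₀ 1 le_rfl (by norm_num)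
  obtain ⟨x₀, hx₀⟩ := hfix g₀ hg₀Z
  have heorb : ∀ x y : X, x ∈ orbit G y → e x = e y := by
    intro x y hxy
    have h1 := hoe x
    rw [orbit_eq_iff.2 hxy, ← hoe y] at h1
    have : 0 < Nat.card (orbit G y) := by
      have : Nonempty (orbit G y) := ⟨⟨y, mem_orbit_self y⟩⟩
      exact Nat.card_pos
    exact Nat.eq_of_mul_eq_mul_left this h1
  have hout : ∀ x : X, x ∈ orbit G (Quotient.mk'' x : orbitRel.Quotient G X).out := by
    intro x
    have h := Quotient.mk_out (s := orbitRel G X) x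
    exact (orbitRel G X).symm h
  have hq : 6 ≤ e (Quotient.mk'' x₀ : orbitRel.Quotient G X).out := by
    rw [← heorb _ _ (hout x₀)]
    by_contra! h
    exact hg₀ (e x₀) (hepos x₀) (by omega) (hpow x₀ g₀ hx₀)
  refine ⟨x₀, ?_⟩
  rcases eq_or_of_sum_one_sub_inv (fun ω : orbitRel.Quotient G X => e ω.out) Z.index
    (fun _ => he2 _) (fun _ => hen _) hsum _ hq with h | ⟨h, h'⟩
  -- Cyclic case: the stabilizer of `x₀` is everything, so its orbit is one point.
  · intro g _
    rw [← heorb _ _ (hout x₀)] at h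
    have h1 := hoe x₀
    rw [h] at h1
    have hi : 0 < Z.index := Nat.pos_of_ne_zero Subgroup.index_ne_zero_of_finite
    have hc : Nat.card (orbit G x₀) = 1 := by nlinarith
    have hss := (Nat.card_eq_one_iff_unique.1 hc).1
    have := hss.elim ⟨g • x₀, mem_orbit x₀ g⟩ ⟨x₀, mem_orbit_self x₀⟩
    exact congrArg Subtype.val this
  -- Dihedral case: the orbit of `x₀` has two points. A fixed point of `g` outside it would force `g
  -- ^ 2 ∈ Z`; a fixed point inside it forces `g` to fix both points.
  · rw [← heorb _ _ (hout x₀)] at h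
    have h1 := hoe x₀
    rw [← h] at h1
    have hc : Nat.card (orbit G x₀) = 2 := Nat.eq_of_mul_eq_mul_right (hepos x₀) h1
    intro g hg
    have hgZ : g ∉ Z := fun h => hg (Z.pow_mem h 2)
    obtain ⟨x, hx⟩ := hfix g hgZ
    by_cases hxx : (Quotient.mk'' x : orbitRel.Quotient G X) = Quotient.mk'' x₀
    · have hxo : x ∈ orbit G x₀ := Quotient.exact hxx
      by_contra hne
      have hxne : x ≠ x₀ := by rintro rfl; exact hne hx
      have h3 : ({x₀, x, g • x₀} : Set X).ncard = 3 := by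
        rw [Set.ncard_eq_three]
        refine ⟨x₀, x, g • x₀, hxne.symm, fun h => hne h.symm, ?_, rfl⟩
        intro h
        rw [← hx] at h
        exact hxne (smul_left_cancel g h)
      have hsub : ({x₀, x, g • x₀} : Set X) ⊆ orbit G x₀ := by
        rintro y (rfl | rfl | rfl)
        · exact mem_orbit_self _
        · exact hxo
        · exact mem_orbit _ _
      have := Set.ncard_le_ncard hsub (Set.toFinite _)
      rw [h3, ← Nat.card_coe_set_eq, hc] at this
      omega
    · have := h' _ hxx
      rw [← heorb _ _ (hout x)] at this
      exact absurd (this ▸ hpow x g hx) hg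

/-! ### Finite subgroups of GL₂ acting on the projective line -/

namespace Matrix.GeneralLinearGroup

open OnePoint MulAction

/-- A non-scalar matrix with a double eigenvalue is parabolic, and in characteristic zero its
positive powers stay parabolic, so none is the identity. -/
theorem mem_center_of_discr_eq_zero {K : Type*} [Field K] [CharZero K] {g : GL (Fin 2) K}
    (hg : IsOfFinOrder g) (h : g.val.trace ^ 2 = 4 * g.val.det) : g ∈ Subgroup.center _ := by
  by_contra hc
  obtain ⟨n, hn, h1⟩ := isOfFinOrder_iff_pow_eq_one.1 hg
  have hp : IsParabolic g := by
    refine ⟨fun hs => hc (mem_center_iff_val_mem_range_scalar.2 hs), ?_⟩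
    rw [discr_fin_two, h, sub_self]
  have := (hp.pow hn.ne').1
  rw [h1] at this
  exact this ⟨1, by simp⟩

/-- The finite fixed points are roots of a quadratic with discriminant tr² - 4 det; when its leading
coefficient vanishes, ∞ replaces the missing root. -/
theorem card_fixedBy_onePoint {K : Type*} [Field K] [DecidableEq K] [IsAlgClosed K] [CharZero K]
    {g : GL (Fin 2) K} (h : g.val.trace ^ 2 ≠ 4 * g.val.det) :
    Nat.card (fixedBy (OnePoint K) g) = 2 := by
  rw [trace_fin_two, det_fin_two] at h
  have hiff : ∀ k : K, g • (k : OnePoint K) = k ↔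
      g 1 0 * k ^ 2 + (g 1 1 - g 0 0) * k - g 0 1 = 0 := by
    intro k
    rw [← fixpointPolynomial_aeval_eq_zero_iff]
    simp [fixpointPolynomial]
  rw [Nat.card_coe_set_eq, Set.ncard_eq_two]
  by_cases hc : g 1 0 = 0
  · have hne : g 1 1 - g 0 0 ≠ 0 := by
      intro h0
      apply h
      rw [hc, sub_eq_zero.1 h0]; ring
    refine ⟨∞, ((g 0 1 / (g 1 1 - g 0 0) : K) : OnePoint K), infty_ne_coe _, ?_⟩
    ext p
    cases p with
    | infty => simp [smul_infty_eq_self_iff, hc]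
    | coe k =>
      rw [mem_fixedBy, hiff, hc]
      simp only [Set.mem_insert_iff, coe_ne_infty, Set.mem_singleton_iff, false_or, coe_eq_coe]
      rw [eq_div_iff hne]
      constructor <;> intro h <;> linear_combination h
  · obtain ⟨s, hs⟩ := IsAlgClosed.exists_pow_nat_eq
      ((g 0 0 + g 1 1) ^ 2 - 4 * (g 0 0 * g 1 1 - g 0 1 * g 1 0)) (n := 2) (by norm_num)
    have hs0 : s ≠ 0 := by
      rintro rfl
      apply h
      linear_combination -hs
    have h2 : (2 * g 1 0 : K) ≠ 0 := mul_ne_zero two_ne_zero hc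
    refine ⟨(((g 0 0 - g 1 1 + s) / (2 * g 1 0) : K) : OnePoint K),
      (((g 0 0 - g 1 1 - s) / (2 * g 1 0) : K) : OnePoint K), ?_, ?_⟩
    · rw [Ne, coe_eq_coe, div_left_inj' h2]
      intro h
      apply hs0
      have : 2 * s = 0 := by linear_combination h
      simpa using this
    · ext p
      cases p with
      | infty => simp [smul_infty_eq_self_iff, hc, infty_ne_coe]
      | coe k =>
        rw [mem_fixedBy, hiff]
        simp only [Set.mem_insert_iff, Set.mem_singleton_iff, coe_eq_coe]
        rw [eq_div_iff h2, eq_div_iff h2]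
        have h4 : (4 * g 1 0 : K) ≠ 0 := mul_ne_zero (by norm_num) hc
        constructor
        · intro h
          have : (k * (2 * g 1 0) - (g 0 0 - g 1 1 + s)) *
              (k * (2 * g 1 0) - (g 0 0 - g 1 1 - s)) = 0 := by
            linear_combination (4 * g 1 0) * h - hs
          rcases mul_eq_zero.1 this with h | h
          · exact Or.inl (sub_eq_zero.1 h)
          · exact Or.inr (sub_eq_zero.1 h)
        · intro h
          rw [← mul_right_inj' h4, mul_zero]
          rcases h with h | h
          · linear_combination (k * (2 * g 1 0) - (g 0 0 - g 1 1 - s)) * h + hs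
          · linear_combination (k * (2 * g 1 0) - (g 0 0 - g 1 1 + s)) * h + hs

/-- A common fixed point is a common eigenline, which gh - hg annihilates. -/
theorem det_commutator_eq_zero {K : Type*} [Field K] [DecidableEq K] {g h : GL (Fin 2) K}
    {p : OnePoint K} (hg : g • p = p) (hh : h • p = p) :
    (g.val * h.val - h.val * g.val).det = 0 := by
  cases p with
  | infty =>
    rw [smul_infty_eq_self_iff] at hg hh
    simp [det_fin_two, Matrix.mul_apply, hg, hh, mul_comm]
  | coe k =>
    rw [← fixpointPolynomial_aeval_eq_zero_iff] at hg hh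
    simp [fixpointPolynomial] at hg hh
    simp [det_fin_two, Matrix.mul_apply]
    have h1 : g 0 1 = g 1 0 * k ^ 2 + (g 1 1 - g 0 0) * k := by linear_combination -hg
    have h2 : h 0 1 = h 1 0 * k ^ 2 + (h 1 1 - h 0 0) * k := by linear_combination -hh
    rw [h1, h2]
    ring

theorem smul_eq_self_of_mem_center {K : Type*} [Field K] [DecidableEq K] {g : GL (Fin 2) K}
    (hg : g ∈ Subgroup.center (GL (Fin 2) K)) (p : OnePoint K) : g • p = p := by
  obtain ⟨a, ha⟩ := mem_center_iff_val_mem_range_scalar.1 hg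
  cases p with
  | infty => rw [smul_infty_eq_self_iff, ← ha]; simp
  | coe k =>
    rw [← fixpointPolynomial_aeval_eq_zero_iff]
    simp [fixpointPolynomial, ← ha]

/-- The points of the projective line that are fixed by a non-scalar element of `Γ`. -/
def poles {K : Type*} [Field K] [DecidableEq K] (Γ : Subgroup (GL (Fin 2) K)) :
    SubMulAction Γ (OnePoint K) where
  carrier := {p | ∃ g : Γ, g.1 ∉ Subgroup.center (GL (Fin 2) K) ∧ g • p = p}
  smul_mem' := by
    rintro h p ⟨g, hg, hp⟩
    refine ⟨h * g * h⁻¹, fun hc => hg ?_, ?_⟩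
    · have := Subgroup.Normal.conj_mem inferInstance _ hc h.1⁻¹
      simpa [mul_assoc] using this
    · rw [mul_smul, mul_smul, inv_smul_smul, hp]

/-- In a finite subgroup of `GL₂(K)`, containing two elements of order at least three modulo
scalars that do not have a common eigenvector, all elements have order at most five modulo
scalars. -/
theorem exists_pow_mem_center {K : Type*} [Field K] [CharZero K] [IsAlgClosed K]
    {Γ : Subgroup (GL (Fin 2) K)} [Finite Γ] {a b : GL (Fin 2) K} (ha : a ∈ Γ) (hb : b ∈ Γ)
    (ha2 : a ^ 2 ∉ Subgroup.center (GL (Fin 2) K)) (hb2 : b ^ 2 ∉ Subgroup.center (GL (Fin 2) K))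
    (hab : (a.val * b.val - b.val * a.val).det ≠ 0) :
    ∀ g ∈ Γ, ∃ e, 1 ≤ e ∧ e ≤ 5 ∧ g ^ e ∈ Subgroup.center (GL (Fin 2) K) := by
  classical
  have hfix : ∀ g : Γ, g.1 ∉ Subgroup.center (GL (Fin 2) K) →
      Nat.card (fixedBy (OnePoint K) g) = 2 := by
    intro g hg
    have h : g.1.val.trace ^ 2 ≠ 4 * g.1.val.det := fun h => hg
      (mem_center_of_discr_eq_zero (Γ.subtype.isOfFinOrder (isOfFinOrder_of_finite g)) h)
    exact card_fixedBy_onePoint h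
  set Z := (Subgroup.center (GL (Fin 2) K)).subgroupOf Γ
  have hfin : Finite (poles Γ) := by
    have : {p : OnePoint K | ∃ g : Γ, g.1 ∉ Subgroup.center (GL (Fin 2) K) ∧ g • p = p}.Finite := by
      have hs : {p : OnePoint K | ∃ g : Γ, g.1 ∉ Subgroup.center (GL (Fin 2) K) ∧ g • p = p} =
          ⋃ g : {g : Γ // g.1 ∉ Subgroup.center (GL (Fin 2) K)}, fixedBy (OnePoint K) g.1 := by
        ext p
        simp
      rw [hs]
      refine Set.finite_iUnion fun g => Set.finite_of_ncard_ne_zero ?_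
      rw [← Nat.card_coe_set_eq, hfix g.1 g.2]
      norm_num
    exact this
  have key := MulAction.exists_fixed_or_pow_mem (X := poles Γ) Z
    (fun z hz x => Subtype.ext (smul_eq_self_of_mem_center (g := z.1) hz x.1))
    (fun g hg => by
      refine Eq.trans ?_ (hfix g hg)
      exact Nat.card_congr ⟨fun x => ⟨x.1.1, congrArg Subtype.val x.2⟩,
        fun x => ⟨⟨x.1, g, hg, x.2⟩, Subtype.ext x.2⟩, fun x => rfl, fun x => rfl⟩)
    (fun x => by
      obtain ⟨g, hg, hx⟩ := x.2
      exact ⟨g, hg, Subtype.ext hx⟩)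
  rcases key with ⟨x, hx⟩ | h
  · exfalso
    apply hab
    have h1 := congrArg Subtype.val (hx ⟨a, ha⟩ ha2)
    have h2 := congrArg Subtype.val (hx ⟨b, hb⟩ hb2)
    exact det_commutator_eq_zero (p := x.1) h1 h2
  · intro g hg
    obtain ⟨e, h1, h5, he⟩ := h ⟨g, hg⟩
    exact ⟨e, h1, h5, he⟩

/-- For eigenvalue ratio ζ one has tr²/det = 2 + ζ + ζ⁻¹, and a scalar e-th power forces ζᵉ = 1; the
listed values are those for e ≤ 5. -/
theorem pow_mem_center_discr {K : Type*} [Field K] [IsAlgClosed K] {g : GL (Fin 2) K} {e : ℕ}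
    (h1 : 1 ≤ e) (h5 : e ≤ 5) (he : g ^ e ∈ Subgroup.center (GL (Fin 2) K)) :
    ∃ x : K, g.val.trace ^ 2 = x * g.val.det ∧
      (x = 0 ∨ x = 1 ∨ x = 2 ∨ x = 4 ∨ x ^ 2 - 3 * x + 1 = 0) := by
  have hd : g.val.det ≠ 0 := g.det_ne_zero
  set d := g.val.det with hdd
  set t := g.val.trace with htt
  refine ⟨t ^ 2 / d, by field_simp, ?_⟩
  obtain ⟨c, hc⟩ := mem_center_iff_val_mem_range_scalar.1 he
  have hCH : g.val ^ 2 = t • g.val - d • 1 := by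
    rw [hdd, htt]
    ext i j
    fin_cases i <;> fin_cases j <;>
      simp [sq, Matrix.mul_apply, trace_fin_two, det_fin_two] <;> ring
  -- Cayley–Hamilton writes every power as p g + q. A scalar power then forces p = 0, unless the
  -- discriminant vanishes.
  have hpow : ∀ n : ℕ, ∀ p q : K, g.val ^ n = p • g.val + q • 1 →
      g.val ^ (n + 1) = (p * t + q) • g.val + (-(p * d)) • 1 := by
    intro n p q h
    rw [pow_succ, h, add_mul, smul_mul_assoc, ← sq, hCH, smul_sub, smul_smul, smul_smul,
      smul_mul_assoc, one_mul]
    module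
  have e1 : g.val ^ 1 = (1 : K) • g.val + (0 : K) • 1 := by simp
  have e2 := hpow 1 _ _ e1
  have e3 := hpow 2 _ _ e2
  have e4 := hpow 3 _ _ e3
  have e5 := hpow 4 _ _ e4
  have hscal : ∀ p q : K, g.val ^ e = p • g.val + q • 1 → t ^ 2 = 4 * d ∨ p = 0 := by
    intro p q h
    rw [or_iff_not_imp_right]
    intro hp
    rw [Units.val_pow_eq_pow_val, h] at hc
    have h01 := congrFun (congrFun hc 0) 1
    have h10 := congrFun (congrFun hc 1) 0
    have h00 := congrFun (congrFun hc 0) 0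
    have h11 := congrFun (congrFun hc 1) 1
    simp [hp] at h01 h10 h00 h11
    have h0 : g.val 0 0 = g.val 1 1 := by
      apply mul_left_cancel₀ hp
      linear_combination h11 - h00
    rw [hdd, htt, trace_fin_two, det_fin_two, h01, h10, h0]
    ring
  have hcases : t ^ 2 = 4 * d ∨ t = 0 ∨ t ^ 2 = d ∨ t ^ 2 = 2 * d ∨
      (t ^ 2) ^ 2 - 3 * t ^ 2 * d + d ^ 2 = 0 := by
    interval_cases e
    · rcases hscal _ _ e1 with h | h
      · exact Or.inl h
      · simp at h
    · rcases hscal _ _ e2 with h | h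
      · exact Or.inl h
      · right; left; simpa using h
    · rcases hscal _ _ e3 with h | h
      · exact Or.inl h
      · right; right; left; linear_combination h
    · rcases hscal _ _ e4 with h | h
      · exact Or.inl h
      · have : t * (t ^ 2 - 2 * d) = 0 := by linear_combination h
        rcases mul_eq_zero.1 this with h | h
        · right; left; exact h
        · right; right; right; left; exact sub_eq_zero.1 h
    · rcases hscal _ _ e5 with h | h
      · exact Or.inl h
      · right; right; right; right; linear_combination h
  rcases hcases with h | h | h | h | h
  · simp [h, hd]
  · simp [h]
  · simp [h, hd]
  · simp [h, hd]
  · right; right; right; right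
    field_simp
    linear_combination h

end Matrix.GeneralLinearGroup

/-! ### Groups generated by a product and the involution that swaps its factors -/

section Swap

variable {H E : Type*} [Group H] [Group E] (L : H × H →* E) (σ : E) (a b : H)

/-- The subgroup generated by an involution `σ` and the images of `(a, 1)` and `(1, b)`. -/
def swapGroup : Subgroup E := Subgroup.closure {σ, L (a, 1), L (1, b)}

/-- The normal closure of `σ` in `swapGroup L σ a b`. -/
def swapNormal : Subgroup E :=
  Subgroup.closure {x | ∃ g ∈ swapGroup L σ a b, x = g * σ * g⁻¹}

variable {L σ a b}

theorem swapGroup_normal_form (hσ : σ * σ = 1) (hL : ∀ x y, σ * L (x, y) = L (y, x) * σ)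
    {g : E} (hg : g ∈ swapGroup L σ a b) : ∃ p, g = L p ∨ g = L p * σ := by
  have hL' : ∀ p : H × H, σ * L p = L p.swap * σ := fun p => hL p.1 p.2
  have hσi : σ⁻¹ = σ := inv_eq_of_mul_eq_one_left hσ
  refine Subgroup.closure_induction ?_ ⟨1, by simp⟩ ?_ ?_ hg
  · rintro x (rfl | rfl | rfl)
    · exact ⟨1, by simp⟩
    · exact ⟨_, Or.inl rfl⟩
    · exact ⟨_, Or.inl rfl⟩
  · rintro x y - - ⟨p, rfl | rfl⟩ ⟨q, rfl | rfl⟩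
    · exact ⟨p * q, Or.inl (map_mul _ _ _).symm⟩
    · exact ⟨p * q, Or.inr (by rw [map_mul, mul_assoc])⟩
    · exact ⟨p * q.swap, Or.inr (by rw [map_mul, mul_assoc, hL', mul_assoc])⟩
    · exact ⟨p * q.swap, Or.inl (by
        rw [map_mul, mul_assoc, ← mul_assoc σ, hL', mul_assoc, hσ, mul_one])⟩
  · rintro x - ⟨p, rfl | rfl⟩
    · exact ⟨p⁻¹, Or.inl (map_inv _ _).symm⟩
    · exact ⟨p⁻¹.swap, Or.inr (by rw [mul_inv_rev, hσi, ← map_inv, hL'])⟩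

/-- A conjugate of `σ` has the form L(p · swap(p)⁻¹) σ, whose two components have inverse images
under χ. Since χ has abelian target, this condition survives products, inverses and swaps. -/
theorem swapNormal_normal_form {C : Type*} [CommGroup C] (χ : H →* C) (hσ : σ * σ = 1)
    (hL : ∀ x y, σ * L (x, y) = L (y, x) * σ) {g : E} (hg : g ∈ swapNormal L σ a b) :
    ∃ p : H × H, χ p.1 * χ p.2 = 1 ∧ (g = L p ∨ g = L p * σ) := by
  have hL' : ∀ p : H × H, σ * L p = L p.swap * σ := fun p => hL p.1 p.2
  have hσi : σ⁻¹ = σ := inv_eq_of_mul_eq_one_left hσ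
  have hmul : ∀ p q : H × H, χ p.1 * χ p.2 = 1 → χ q.1 * χ q.2 = 1 →
      χ (p * q).1 * χ (p * q).2 = 1 := by
    intro p q hp hq
    rw [Prod.fst_mul, Prod.snd_mul, map_mul, map_mul, mul_mul_mul_comm, hp, hq, one_mul]
  have hswap : ∀ p : H × H, χ p.1 * χ p.2 = 1 → χ p.swap.1 * χ p.swap.2 = 1 := by
    intro p hp
    rw [Prod.fst_swap, Prod.snd_swap, mul_comm, hp]
  have hinv : ∀ p : H × H, χ p.1 * χ p.2 = 1 → χ p⁻¹.1 * χ p⁻¹.2 = 1 := by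
    intro p hp
    rw [Prod.fst_inv, Prod.snd_inv, map_inv, map_inv, ← mul_inv, hp, inv_one]
  refine Subgroup.closure_induction ?_ ⟨1, by simp⟩ ?_ ?_ hg
  · rintro _ ⟨g, hg, rfl⟩
    obtain ⟨p, rfl | rfl⟩ := swapGroup_normal_form hσ hL hg
    · refine ⟨p * p⁻¹.swap, ?_, Or.inr ?_⟩
      · simp [mul_comm]
      · rw [mul_assoc, ← map_inv, hL', map_mul, mul_assoc]
    · refine ⟨p * p⁻¹.swap, ?_, Or.inr ?_⟩
      · simp [mul_comm]
      · rw [mul_inv_rev, hσi, mul_assoc (L p), hσ, mul_one, ← map_inv, hL', map_mul, mul_assoc]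
  · rintro x y - - ⟨p, hp, rfl | rfl⟩ ⟨q, hq, rfl | rfl⟩
    · exact ⟨p * q, hmul p q hp hq, Or.inl (map_mul _ _ _).symm⟩
    · exact ⟨p * q, hmul p q hp hq, Or.inr (by rw [map_mul, mul_assoc])⟩
    · exact ⟨p * q.swap, hmul p _ hp (hswap q hq),
        Or.inr (by rw [map_mul, mul_assoc, hL', mul_assoc])⟩
    · exact ⟨p * q.swap, hmul p _ hp (hswap q hq), Or.inl (by
        rw [map_mul, mul_assoc, ← mul_assoc σ, hL', mul_assoc, hσ, mul_one])⟩
  · rintro x - ⟨p, hp, rfl | rfl⟩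
    · exact ⟨p⁻¹, hinv p hp, Or.inl (map_inv _ _).symm⟩
    · exact ⟨p⁻¹.swap, hswap _ (hinv p hp), Or.inr (by rw [mul_inv_rev, hσi, ← map_inv, hL'])⟩

/-- The hypothesis `hne` excludes the normal form with a factor `σ`, and `hker` makes χ(xy)
independent of the pair representing the element. -/
theorem mul_mem_ker_of_mem_swapNormal {C : Type*} [CommGroup C] (χ : H →* C) (hσ : σ * σ = 1)
    (hL : ∀ x y, σ * L (x, y) = L (y, x) * σ) (hker : ∀ x y, L (x, y) = 1 → x * y = 1)
    (hne : ∀ x y, L (x, y) ≠ σ) {x y : H} (hxy : L (x, y) ∈ swapNormal L σ a b) :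
    χ (x * y) = 1 := by
  obtain ⟨p, hp, h | h⟩ := swapNormal_normal_form χ hσ hL hxy
  · have h1 : L (x * p.1⁻¹, y * p.2⁻¹) = 1 := by
      rw [show (x * p.1⁻¹, y * p.2⁻¹) = (x, y) * p⁻¹ from rfl, map_mul, map_inv, h, mul_inv_cancel]
    have h2 := congrArg χ (hker _ _ h1)
    rw [map_mul, map_mul, map_mul, map_inv, map_inv, map_one, mul_mul_mul_comm, ← mul_inv, hp,
      inv_one, mul_one] at h2
    rw [map_mul, h2]
  · exfalso
    apply hne (p.1⁻¹ * x) (p.2⁻¹ * y)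
    rw [show (p.1⁻¹ * x, p.2⁻¹ * y) = p⁻¹ * (x, y) from rfl, map_mul, map_inv, h,
      inv_mul_cancel_left]

theorem map_prod_one_mem_swapGroup (hσ : σ * σ = 1)
    (hL : ∀ x y, σ * L (x, y) = L (y, x) * σ) (hab : Subgroup.closure {a, b} = ⊤) (g : H) :
    L (g, 1) ∈ swapGroup L σ a b := by
  have hσm : σ ∈ swapGroup L σ a b := Subgroup.subset_closure (by simp)
  have hg : g ∈ Subgroup.closure {a, b} := hab ▸ Subgroup.mem_top g
  refine Subgroup.closure_induction ?_ ?_ ?_ ?_ hg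
  · rintro x (rfl | rfl)
    · exact Subgroup.subset_closure (by simp)
    · have : L (x, 1) = σ * L (1, x) * σ := by rw [hL, mul_assoc, hσ, mul_one]
      rw [this]
      exact mul_mem (mul_mem hσm (Subgroup.subset_closure (by simp))) hσm
  · rw [show ((1 : H), (1 : H)) = 1 from rfl, map_one]
    exact one_mem _
  · intro x y _ _ hx hy
    rw [show (x * y, (1 : H)) = (x, 1) * (y, 1) by simp, map_mul]
    exact mul_mem hx hy
  · intro x _ hx
    rw [show (x⁻¹, (1 : H)) = (x, 1)⁻¹ by simp, map_inv]
    exact inv_mem hx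

/-- This element is the commutator of L(g, 1) and the involution `σ`. -/
theorem map_inv_mem_swapNormal (hσ : σ * σ = 1)
    (hL : ∀ x y, σ * L (x, y) = L (y, x) * σ) (hab : Subgroup.closure {a, b} = ⊤) (g : H) :
    L (g, g⁻¹) ∈ swapNormal L σ a b := by
  have h1 : σ ∈ swapNormal L σ a b := Subgroup.subset_closure ⟨1, one_mem _, by simp⟩
  have h2 : L (g, 1) * σ * (L (g, 1))⁻¹ ∈ swapNormal L σ a b :=
    Subgroup.subset_closure ⟨_, map_prod_one_mem_swapGroup hσ hL hab g, rfl⟩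
  have : L (g, g⁻¹) = L (g, 1) * σ * (L (g, 1))⁻¹ * σ := by
    rw [← map_inv, mul_assoc (L (g, 1)), show (g, (1 : H))⁻¹ = (g⁻¹, 1) by simp, hL, mul_assoc,
      mul_assoc, hσ, mul_one, ← map_mul]
    simp
  rw [this]
  exact mul_mem h2 h1

theorem mem_swapNormal_of_mul_mem_commutator (hσ : σ * σ = 1)
    (hL : ∀ x y, σ * L (x, y) = L (y, x) * σ) (hab : Subgroup.closure {a, b} = ⊤) {x y : H}
    (hxy : x * y ∈ commutator H) : L (x, y) ∈ swapNormal L σ a b := by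
  have hc : ∀ c ∈ commutator H, L (c, 1) ∈ swapNormal L σ a b := by
    intro c hc
    rw [commutator_eq_closure] at hc
    refine Subgroup.closure_induction ?_ ?_ ?_ ?_ hc
    · rintro _ ⟨g, h, rfl⟩
      rw [commutatorElement_def]
      -- In the second component the three factors cancel: g⁻¹h⁻¹ · hg = 1.
      have : L (g * h * g⁻¹ * h⁻¹, 1) = L (g, g⁻¹) * L (h, h⁻¹) * L ((h * g)⁻¹, (h * g)⁻¹⁻¹) := by
        rw [← map_mul, ← map_mul]
        congr 1
        ext <;> simp [mul_assoc]
      rw [this]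
      exact mul_mem (mul_mem (map_inv_mem_swapNormal hσ hL hab g)
        (map_inv_mem_swapNormal hσ hL hab h)) (map_inv_mem_swapNormal hσ hL hab _)
    · rw [show ((1 : H), (1 : H)) = 1 from rfl, map_one]
      exact one_mem _
    · intro x y _ _ hx hy
      rw [show (x * y, (1 : H)) = (x, 1) * (y, 1) by simp, map_mul]
      exact mul_mem hx hy
    · intro x _ hx
      rw [show (x⁻¹, (1 : H)) = (x, 1)⁻¹ by simp, map_inv]
      exact inv_mem hx
  have : L (x, y) = L (x * y, 1) * L (y⁻¹, y⁻¹⁻¹) := by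
    rw [← map_mul]
    simp
  rw [this]
  exact mul_mem (hc _ hxy) (map_inv_mem_swapNormal hσ hL hab _)

end Swap

namespace AppellF4

open Matrix

/-! ### The two-dimensional group -/

section Rank2

variable {R S : Type*} [CommRing R] [CommRing S]

/-- An upper triangular pseudo-reflection. -/
def reflA (u : Rˣ) : GL (Fin 2) R :=
  ⟨!![1, 1; 0, (u : R)], !![1, -((u⁻¹ : Rˣ) : R); 0, ((u⁻¹ : Rˣ) : R)],
    by ext i j; fin_cases i <;> fin_cases j <;> simp [Matrix.mul_apply],
    by ext i j; fin_cases i <;> fin_cases j <;> simp [Matrix.mul_apply]⟩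

/-- A lower triangular pseudo-reflection. -/
def reflB (v : Rˣ) (y : R) : GL (Fin 2) R :=
  ⟨!![1, 0; y, (v : R)], !![1, 0; -(((v⁻¹ : Rˣ) : R) * y), ((v⁻¹ : Rˣ) : R)],
    by ext i j; fin_cases i <;> fin_cases j <;> simp [Matrix.mul_apply],
    by ext i j; fin_cases i <;> fin_cases j <;> simp [Matrix.mul_apply]⟩

/-- The group generated by two pseudo-reflections. -/
def reflGroup (u v : Rˣ) (y : R) : Subgroup (GL (Fin 2) R) :=
  Subgroup.closure {reflA u, reflB v y}

@[simp] theorem coe_reflA (u : Rˣ) : (reflA u : Matrix (Fin 2) (Fin 2) R) = !![1, 1; 0, (u : R)] :=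
  rfl

@[simp] theorem coe_reflB (v : Rˣ) (y : R) :
    (reflB v y : Matrix (Fin 2) (Fin 2) R) = !![1, 0; y, (v : R)] :=
  rfl

theorem reflA_mem (u v : Rˣ) (y : R) : reflA u ∈ reflGroup u v y :=
  Subgroup.subset_closure (by simp)

theorem reflB_mem (u v : Rˣ) (y : R) : reflB v y ∈ reflGroup u v y :=
  Subgroup.subset_closure (by simp)

@[simp] theorem map_reflA (f : R →+* S) (u : Rˣ) :
    GeneralLinearGroup.map f (reflA u) = reflA (Units.map (f : R →* S) u) := by
  ext i j
  fin_cases i <;> fin_cases j <;> simp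

@[simp] theorem map_reflB (f : R →+* S) (v : Rˣ) (y : R) :
    GeneralLinearGroup.map f (reflB v y) = reflB (Units.map (f : R →* S) v) (f y) := by
  ext i j
  fin_cases i <;> fin_cases j <;> simp

theorem map_reflGroup (f : R →+* S) (u v : Rˣ) (y : R) :
    (reflGroup u v y).map (GeneralLinearGroup.map f) =
      reflGroup (Units.map (f : R →* S) u) (Units.map (f : R →* S) v) (f y) := by
  rw [reflGroup, MonoidHom.map_closure, Set.image_pair, map_reflA, map_reflB, reflGroup]

theorem map_commutator_reflGroup (f : R →+* S) (u v : Rˣ) (y : R) :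
    (⁅reflGroup u v y, reflGroup u v y⁆).map (GeneralLinearGroup.map f) =
      ⁅reflGroup (Units.map (f : R →* S) u) (Units.map (f : R →* S) v) (f y),
        reflGroup (Units.map (f : R →* S) u) (Units.map (f : R →* S) v) (f y)⁆ := by
  rw [Subgroup.map_commutator, map_reflGroup]

end Rank2

/-! ### The action on `2 × 2` matrices -/

/-- `(x, y)` acts on `2 × 2` matrices by `X ↦ x X adj(y)`. -/
def sandwich : GL (Fin 2) ℂ × GL (Fin 2) ℂ →* Equiv.Perm (Matrix (Fin 2) (Fin 2) ℂ) :=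
  MonoidHom.toHomPerm
    { toFun := fun p X => p.1.val * X * p.2.val.adjugate
      map_one' := by
        funext X
        change (1 : Matrix (Fin 2) (Fin 2) ℂ) * X * (1 : Matrix (Fin 2) (Fin 2) ℂ).adjugate = X
        simp
      map_mul' := fun p q => by
        funext X
        change _ = p.1.val * (q.1.val * X * q.2.val.adjugate) * p.2.val.adjugate
        simp [Matrix.adjugate_mul_distrib, mul_assoc] }

@[simp] theorem sandwich_apply (p : GL (Fin 2) ℂ × GL (Fin 2) ℂ) (X : Matrix (Fin 2) (Fin 2) ℂ) :
    sandwich p X = p.1.val * X * p.2.val.adjugate := rfl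

theorem adjugate_adjugate_fin_two {R : Type*} [CommRing R] (X : Matrix (Fin 2) (Fin 2) R) :
    X.adjugate.adjugate = X := by
  simp [adjugate_fin_two]
  exact (eta_fin_two X).symm

/-- The involution `X ↦ -adj(X)` of `2 × 2` matrices. -/
def negAdj : Equiv.Perm (Matrix (Fin 2) (Fin 2) ℂ) where
  toFun X := -X.adjugate
  invFun X := -X.adjugate
  left_inv X := by
    have h : (-X.adjugate).adjugate = -X.adjugate.adjugate := by simp [adjugate_fin_two]
    simp only [h, adjugate_adjugate_fin_two, neg_neg]
  right_inv X := by
    have h : (-X.adjugate).adjugate = -X.adjugate.adjugate := by simp [adjugate_fin_two]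
    simp only [h, adjugate_adjugate_fin_two, neg_neg]

@[simp] theorem negAdj_apply (X : Matrix (Fin 2) (Fin 2) ℂ) : negAdj X = -X.adjugate := rfl

theorem negAdj_mul_self : negAdj * negAdj = 1 := Equiv.ext negAdj.left_inv

theorem negAdj_mul_sandwich (x y : GL (Fin 2) ℂ) :
    negAdj * sandwich (x, y) = sandwich (y, x) * negAdj := by
  ext1 X
  simp [Matrix.adjugate_mul_distrib, adjugate_adjugate_fin_two, mul_assoc]

/-- Evaluating at 1 gives adj(y) = x⁻¹, so x commutes with all matrices and is scalar. A scalar 2 ×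
2 matrix is its own adjugate, and taking adjugates gives yx = 1. -/
theorem mul_eq_one_of_sandwich_eq_one {x y : GL (Fin 2) ℂ} (h : sandwich (x, y) = 1) :
    x * y = 1 := by
  have h' : ∀ X, x.val * X * y.val.adjugate = X := fun X => Equiv.congr_fun h X
  have h1 := h' 1
  rw [mul_one] at h1
  have hcomm : ∀ X, x.val * X = X * x.val := by
    intro X
    have h2 : y.val.adjugate * x.val = 1 := mul_eq_one_comm.1 h1
    calc x.val * X = x.val * X * (y.val.adjugate * x.val) := by rw [h2, mul_one]
      _ = X * x.val := by rw [← mul_assoc, h']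
  have hc : x ∈ Subgroup.center (GL (Fin 2) ℂ) :=
    Subgroup.mem_center_iff.2 fun g => Units.ext (hcomm g.val).symm
  obtain ⟨c, hc⟩ := GeneralLinearGroup.mem_center_iff_val_mem_range_scalar.1 hc
  have hadj : x.val.adjugate = x.val := by
    rw [← hc]
    ext i j
    fin_cases i <;> fin_cases j <;> simp
  have h3 := congrArg adjugate h1
  rw [adjugate_mul_distrib, adjugate_adjugate_fin_two, hadj, adjugate_one] at h3
  exact Units.ext (mul_eq_one_comm.1 h3)

/-- Equality would give xX = adj(X)x for all X; two matrix units already force the first column of x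
to vanish. -/
theorem sandwich_ne_negAdj (x y : GL (Fin 2) ℂ) : sandwich (x, y) ≠ negAdj := by
  intro h
  have h' : ∀ X, x.val * X * y.val.adjugate = -X.adjugate := fun X => Equiv.congr_fun h X
  have h1 := h' 1
  rw [mul_one, adjugate_one] at h1
  have hcomm : ∀ X, x.val * X = X.adjugate * x.val := by
    intro X
    have h2 : y.val.adjugate * x.val = -1 := by
      have : -x.val * y.val.adjugate = 1 := by rw [neg_mul, h1, neg_neg]
      have := mul_eq_one_comm.1 this
      rw [mul_neg] at this
      rw [← this, neg_neg]
    calc x.val * X = -(x.val * X * (y.val.adjugate * x.val)) := by rw [h2]; simp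
      _ = X.adjugate * x.val := by rw [← mul_assoc, h']; simp
  have e1 := hcomm !![1, 0; 0, 0]
  have e2 := hcomm !![0, 1; 0, 0]
  have a1 := congrFun (congrFun e1 0) 0
  have a2 := congrFun (congrFun e2 0) 0
  simp [adjugate_fin_two, Matrix.mul_apply] at a1 a2
  apply x.det_ne_zero
  rw [det_fin_two, a1, a2]
  ring

/-! ### The intertwining map -/

/-- The linear map `ℂ⁴ → M₂(ℂ)` sending `e₁₁` to `1` and intertwining `M₁`, `M₂` with
multiplication by `reflA` and the adjugate of `reflB`. -/
noncomputable def toMat (u v : ℂˣ) (y : ℂ) : (Fin 4 → ℂ) →ₗ[ℂ] Matrix (Fin 2) (Fin 2) ℂ where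
  toFun w := !![-(w 0 * (u : ℂ)⁻¹ * (v : ℂ)⁻¹ * y) + w 2 * (1 - (u : ℂ)⁻¹) + w 3,
      - (w 0 * (u : ℂ)⁻¹ * (1 - (v : ℂ)⁻¹)) - w 2 * (u : ℂ)⁻¹;
    w 1 * (v : ℂ)⁻¹ * y, w 1 * (1 - (v : ℂ)⁻¹) + w 3]
  map_add' w w' := by ext i j; fin_cases i <;> fin_cases j <;> simp <;> ring
  map_smul' c w := by ext i j; fin_cases i <;> fin_cases j <;> simp <;> ring

theorem toMat_apply (u v : ℂˣ) (y : ℂ) (w : Fin 4 → ℂ) : toMat u v y w =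
    !![-(w 0 * (u : ℂ)⁻¹ * (v : ℂ)⁻¹ * y) + w 2 * (1 - (u : ℂ)⁻¹) + w 3,
      - (w 0 * (u : ℂ)⁻¹ * (1 - (v : ℂ)⁻¹)) - w 2 * (u : ℂ)⁻¹;
    w 1 * (v : ℂ)⁻¹ * y, w 1 * (1 - (v : ℂ)⁻¹) + w 3] := rfl

theorem toMat_M1 (γ₁ γ₂ : ℂˣ) (y : ℂ) (w : Fin 4 → ℂ) :
    toMat γ₁⁻¹ γ₂⁻¹ y (M1 γ₁ • w) =
      sandwich (reflA γ₁⁻¹, 1) (toMat γ₁⁻¹ γ₂⁻¹ y w) := by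
  have h₁ := γ₁.ne_zero
  have h₂ := γ₂.ne_zero
  have hw : M1 γ₁ • w = ![w 0 - (γ₁ : ℂ)⁻¹ * w 1, (γ₁ : ℂ)⁻¹ * w 1, w 2 - (γ₁ : ℂ)⁻¹ * w 3,
      (γ₁ : ℂ)⁻¹ * w 3] := by
    ext i
    fin_cases i <;>
      simp [M1, mat1, Units.smul_def, mulVec, dotProduct, Fin.sum_univ_four,
        GeneralLinearGroup.mkOfDetNeZero] <;> ring
  rw [hw, toMat_apply, sandwich_apply, toMat_apply]
  ext i j
  fin_cases i <;> fin_cases j <;> simp [Matrix.mul_apply] <;> field_simp <;> ring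

theorem toMat_M2 (γ₁ γ₂ : ℂˣ) (y : ℂ) (w : Fin 4 → ℂ) :
    toMat γ₁⁻¹ γ₂⁻¹ y (M2 γ₂ • w) =
      sandwich (1, reflB γ₂⁻¹ y) (toMat γ₁⁻¹ γ₂⁻¹ y w) := by
  have h₁ := γ₁.ne_zero
  have h₂ := γ₂.ne_zero
  have hw : M2 γ₂ • w = ![w 0 - (γ₂ : ℂ)⁻¹ * w 2, w 1 - (γ₂ : ℂ)⁻¹ * w 3, (γ₂ : ℂ)⁻¹ * w 2,
      (γ₂ : ℂ)⁻¹ * w 3] := by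
    ext i
    fin_cases i <;>
      simp [M2, mat2, Units.smul_def, mulVec, dotProduct, Fin.sum_univ_four,
        GeneralLinearGroup.mkOfDetNeZero] <;> ring
  rw [hw, toMat_apply, sandwich_apply, toMat_apply]
  ext i j
  fin_cases i <;> fin_cases j <;> simp [Matrix.mul_apply, adjugate_fin_two] <;> field_simp <;> ring

/-- The lower left entry of `reflB` in the model of the monodromy group. -/
noncomputable def offDiag (α β : ℂˣ) : ℂ := (α : ℂ)⁻¹ + (β : ℂ)⁻¹ - 1 - (α : ℂ)⁻¹ * (β : ℂ)⁻¹

/-- The relation γ₁γ₂ = αβ turns the last diagonal entry of M₀ into -1, so that M₀ can match an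
involution. -/
theorem toMat_M0 {α β γ₁ γ₂ : ℂˣ} (h : γ₁ * γ₂ = α * β) (w : Fin 4 → ℂ) :
    toMat γ₁⁻¹ γ₂⁻¹ (offDiag α β) (M0 α β γ₁ γ₂ • w) =
      negAdj (toMat γ₁⁻¹ γ₂⁻¹ (offDiag α β) w) := by
  have ha := α.ne_zero
  have hb := β.ne_zero
  have h₁ := γ₁.ne_zero
  have hg : (γ₂ : ℂ) = α * β / γ₁ := by
    rw [eq_div_iff h₁, mul_comm]
    exact_mod_cast congrArg Units.val h
  have hw : M0 α β γ₁ γ₂ • w = ![w 0, w 1, w 2,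
      -(((α : ℂ) - 1) * ((β : ℂ) - 1) * γ₁ * γ₂ / (α * β)) * w 0 +
      ((α : ℂ) * β - γ₁) * γ₂ / (α * β) * w 1 +
      ((α : ℂ) * β - γ₂) * γ₁ / (α * β) * w 2 -
      (γ₁ : ℂ) * γ₂ / (α * β) * w 3] := by
    ext i
    fin_cases i <;>
      simp [M0, mat0, Units.smul_def, mulVec, dotProduct, Fin.sum_univ_four,
        GeneralLinearGroup.mkOfDetNeZero]
    ring
  rw [hw, toMat_apply, negAdj_apply, toMat_apply]
  ext i j
  fin_cases i <;> fin_cases j <;> simp [adjugate_fin_two, offDiag, hg] <;> field_simp <;> ring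

/-! ### Transport of the monodromy group to `2 × 2` matrices -/

variable {α β γ₁ γ₂ : ℂˣ}

theorem toMat_smul_eq_zero_iff (h : γ₁ * γ₂ = α * β) {g : GL (Fin 4) ℂ}
    (hg : g ∈ Mon α β γ₁ γ₂) (w : Fin 4 → ℂ) :
    toMat γ₁⁻¹ γ₂⁻¹ (offDiag α β) (g • w) = 0 ↔ toMat γ₁⁻¹ γ₂⁻¹ (offDiag α β) w = 0 := by
  refine Subgroup.closure_induction
    (p := fun g _ => ∀ w, toMat γ₁⁻¹ γ₂⁻¹ (offDiag α β) (g • w) = 0 ↔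
      toMat γ₁⁻¹ γ₂⁻¹ (offDiag α β) w = 0) ?_ ?_ ?_ ?_ hg w
  · have key : ∀ (P : Equiv.Perm (Matrix (Fin 2) (Fin 2) ℂ)), P 0 = 0 → ∀ X, P X = 0 ↔ X = 0 :=
      fun P hP X => ⟨fun h => P.injective (h.trans hP.symm), fun h => h ▸ hP⟩
    rintro x (rfl | rfl | rfl) w
    · rw [toMat_M0 h]
      exact key _ (by simp) _
    · rw [toMat_M1]
      exact key _ (by simp) _
    · rw [toMat_M2]
      exact key _ (by simp) _
  · intro w
    rw [one_smul]
  · intro x y _ _ hx hy w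
    rw [mul_smul, hx, hy]
  · intro x _ hx w
    rw [← hx, smul_inv_smul]

/-- The kernel is a subrepresentation and omits e₁₁, which maps to 1; irreducibility leaves only the
zero kernel. -/
theorem toMat_injective (h : γ₁ * γ₂ = α * β) (hfin : FiniteIrreducible (Mon α β γ₁ γ₂)) :
    Function.Injective (toMat γ₁⁻¹ γ₂⁻¹ (offDiag α β)) := by
  have := hfin.2
  let W : Subrepresentation (tautRep (Mon α β γ₁ γ₂)) :=
    { toSubmodule := LinearMap.ker (toMat γ₁⁻¹ γ₂⁻¹ (offDiag α β))
      apply_mem_toSubmodule := fun g v hv =>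
        LinearMap.mem_ker.2 ((toMat_smul_eq_zero_iff h g.2 v).2 (LinearMap.mem_ker.1 hv)) }
  rcases IsSimpleOrder.eq_bot_or_eq_top W with hW | hW
  · rw [← LinearMap.ker_eq_bot]
    exact congrArg Subrepresentation.toSubmodule hW
  · exfalso
    have h1 : ![0, 0, 0, 1] ∈ LinearMap.ker (toMat γ₁⁻¹ γ₂⁻¹ (offDiag α β)) := by
      have : LinearMap.ker (toMat γ₁⁻¹ γ₂⁻¹ (offDiag α β)) = ⊤ :=
        congrArg Subrepresentation.toSubmodule hW
      rw [this]
      trivial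
    rw [LinearMap.mem_ker, toMat_apply] at h1
    have := congrFun (congrFun h1 0) 0
    simp at this

/-- The isomorphism `ℂ⁴ ≃ M₂(ℂ)`. -/
noncomputable def toMatEquiv (h : γ₁ * γ₂ = α * β)
    (hfin : FiniteIrreducible (Mon α β γ₁ γ₂)) :
    (Fin 4 → ℂ) ≃ₗ[ℂ] Matrix (Fin 2) (Fin 2) ℂ :=
  LinearEquiv.ofInjectiveOfFinrankEq (toMat γ₁⁻¹ γ₂⁻¹ (offDiag α β)) (toMat_injective h hfin)
    (by rw [Module.finrank_matrix]; simp)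

theorem toMatEquiv_apply (h : γ₁ * γ₂ = α * β) (hfin : FiniteIrreducible (Mon α β γ₁ γ₂))
    (w : Fin 4 → ℂ) : toMatEquiv h hfin w = toMat γ₁⁻¹ γ₂⁻¹ (offDiag α β) w := rfl

/-- The action of `GL₄(ℂ)` on `M₂(ℂ)` through the isomorphism `ℂ⁴ ≃ M₂(ℂ)`. -/
noncomputable def matAction (h : γ₁ * γ₂ = α * β) (hfin : FiniteIrreducible (Mon α β γ₁ γ₂)) :
    GL (Fin 4) ℂ →* Equiv.Perm (Matrix (Fin 2) (Fin 2) ℂ) :=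
  (toMatEquiv h hfin).toEquiv.permCongrHom.toMonoidHom.comp
    (MulAction.toPermHom (GL (Fin 4) ℂ) (Fin 4 → ℂ))

theorem matAction_apply (h : γ₁ * γ₂ = α * β) (hfin : FiniteIrreducible (Mon α β γ₁ γ₂))
    (g : GL (Fin 4) ℂ) (w : Fin 4 → ℂ) :
    matAction h hfin g (toMatEquiv h hfin w) = toMatEquiv h hfin (g • w) := by
  simp [matAction, Equiv.permCongrHom]

theorem matAction_eq_of (h : γ₁ * γ₂ = α * β) (hfin : FiniteIrreducible (Mon α β γ₁ γ₂))
    {g : GL (Fin 4) ℂ} {P : Equiv.Perm (Matrix (Fin 2) (Fin 2) ℂ)}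
    (hP : ∀ w, toMatEquiv h hfin (g • w) = P (toMatEquiv h hfin w)) : matAction h hfin g = P := by
  ext1 X
  obtain ⟨w, rfl⟩ := (toMatEquiv h hfin).surjective X
  rw [matAction_apply, hP]

theorem matAction_injective (h : γ₁ * γ₂ = α * β) (hfin : FiniteIrreducible (Mon α β γ₁ γ₂)) :
    Function.Injective (matAction h hfin) := by
  intro g g' hgg
  have : ∀ w : Fin 4 → ℂ, g.val *ᵥ w = g'.val *ᵥ w := by
    intro w
    apply (toMatEquiv h hfin).injective
    have := congrArg (fun P : Equiv.Perm _ => P (toMatEquiv h hfin w)) hgg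
    simp only [matAction_apply] at this
    exact this
  exact Units.ext (Matrix.mulVec_injective (funext this))

theorem matAction_M0 (h : γ₁ * γ₂ = α * β) (hfin : FiniteIrreducible (Mon α β γ₁ γ₂)) :
    matAction h hfin (M0 α β γ₁ γ₂) = negAdj :=
  matAction_eq_of h hfin (toMat_M0 h)

theorem matAction_M1 (h : γ₁ * γ₂ = α * β) (hfin : FiniteIrreducible (Mon α β γ₁ γ₂)) :
    matAction h hfin (M1 γ₁) = sandwich (reflA γ₁⁻¹, 1) :=
  matAction_eq_of h hfin (toMat_M1 _ _ _)

theorem matAction_M2 (h : γ₁ * γ₂ = α * β) (hfin : FiniteIrreducible (Mon α β γ₁ γ₂)) :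
    matAction h hfin (M2 γ₂) = sandwich (1, reflB γ₂⁻¹ (offDiag α β)) :=
  matAction_eq_of h hfin (toMat_M2 _ _ _)

theorem matAction_M1_zpow_mul_M2_zpow (h : γ₁ * γ₂ = α * β)
    (hfin : FiniteIrreducible (Mon α β γ₁ γ₂)) (i j : ℤ) :
    matAction h hfin (M1 γ₁ ^ i * M2 γ₂ ^ j) =
      sandwich (reflA γ₁⁻¹ ^ i, reflB γ₂⁻¹ (offDiag α β) ^ j) := by
  rw [map_mul, map_zpow, map_zpow, matAction_M1, matAction_M2, ← map_zpow, ← map_zpow, ← map_mul]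
  simp

/-- `reflA` and `reflB` have no common eigenvector. -/
theorem offDiag_ne_zero (h : γ₁ * γ₂ = α * β) (hfin : FiniteIrreducible (Mon α β γ₁ γ₂)) :
    offDiag α β ≠ 0 := by
  intro h0
  obtain ⟨w, hw⟩ := (toMatEquiv h hfin).surjective !![0, 0; 1, 0]
  rw [toMatEquiv_apply, toMat_apply, h0] at hw
  have := congrFun (congrFun hw 1) 0
  simp at this

/-- This is the second factor of det(AB - BA). If it vanished, (1, u - 1) would be a common
eigenvector of A and B, and `toMat` could not be surjective. -/
theorem offDiag_add_ne_zero (h : γ₁ * γ₂ = α * β) (hfin : FiniteIrreducible (Mon α β γ₁ γ₂)) :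
    offDiag α β + ((γ₁ : ℂ)⁻¹ - 1) * ((γ₂ : ℂ)⁻¹ - 1) ≠ 0 := by
  intro h0
  have h0 : offDiag α β = -(((γ₁ : ℂ)⁻¹ - 1) * ((γ₂ : ℂ)⁻¹ - 1)) := by linear_combination h0
  obtain ⟨w, hw⟩ := (toMatEquiv h hfin).surjective !![0, 0; 1, 0]
  rw [toMatEquiv_apply, toMat_apply, h0] at hw
  have e00 := congrFun (congrFun hw 0) 0
  have e01 := congrFun (congrFun hw 0) 1
  have e10 := congrFun (congrFun hw 1) 0
  have e11 := congrFun (congrFun hw 1) 1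
  have h₁ := γ₁.ne_zero
  have h₂ := γ₂.ne_zero
  simp only [Units.val_inv_eq_inv_val, inv_inv, of_apply, cons_val', cons_val_zero,
    cons_val_fin_one, cons_val_one] at e00 e01 e10 e11
  set a := (γ₁ : ℂ)
  set b := (γ₂ : ℂ)
  -- With u = a⁻¹ this is the row (-(u - 1), 1) times X times the column (1, u - 1), for X in the
  -- image of `toMat`. It vanishes exactly when (1, u - 1) is mapped by X into its own line, which
  -- fails for the chosen target.
  have key : w 1 * b * -((a⁻¹ - 1) * (b⁻¹ - 1)) + (a⁻¹ - 1) * (w 1 * (1 - b) + w 3) -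
      (a⁻¹ - 1) * (-(w 0 * a * b * -((a⁻¹ - 1) * (b⁻¹ - 1))) + w 2 * (1 - a) + w 3) -
      (a⁻¹ - 1) ^ 2 * (-(w 0 * a * (1 - b)) - w 2 * a) = 0 := by
    field_simp
    ring
  rw [e00, e01, e10, e11] at key
  simp at key

/-! ### Determinants and powers of the two reflections -/

theorem det_eq_one_of_mem_commutator {R : Type*} [CommRing R] {Γ : Subgroup (GL (Fin 2) R)}
    {g : GL (Fin 2) R} (hg : g ∈ ⁅Γ, Γ⁆) : GeneralLinearGroup.det g = 1 := by
  have h1 : ⁅Γ, Γ⁆ ≤ commutator (GL (Fin 2) R) := by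
    rw [commutator_def]
    exact Subgroup.commutator_mono le_top le_top
  exact Abelianization.commutator_subset_ker GeneralLinearGroup.det (h1 hg)

@[simp] theorem det_reflA {R : Type*} [CommRing R] (u : Rˣ) :
    GeneralLinearGroup.det (reflA u) = u := by
  ext
  simp [det_fin_two]

@[simp] theorem det_reflB {R : Type*} [CommRing R] (v : Rˣ) (y : R) :
    GeneralLinearGroup.det (reflB v y) = v := by
  ext
  simp [det_fin_two]

theorem reflA_pow {R : Type*} [CommRing R] (u : Rˣ) (n : ℕ) :
    (reflA u ^ n).val = !![1, ∑ i ∈ Finset.range n, (u : R) ^ i; 0, (u : R) ^ n] := by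
  induction n with
  | zero => simp [one_fin_two]
  | succ n ih =>
    rw [pow_succ, Units.val_mul, ih, geom_sum_succ']
    ext i j
    fin_cases i <;> fin_cases j <;> simp [Matrix.mul_apply, pow_succ]
    have := mul_geom_sum (u : R) n
    linear_combination this

theorem reflB_pow {R : Type*} [CommRing R] (v : Rˣ) (y : R) (n : ℕ) :
    (reflB v y ^ n).val = !![1, 0; (∑ i ∈ Finset.range n, (v : R) ^ i) * y, (v : R) ^ n] := by
  induction n with
  | zero => simp [one_fin_two]
  | succ n ih =>
    rw [pow_succ, Units.val_mul, ih, geom_sum_succ']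
    ext i j
    fin_cases i <;> fin_cases j <;> simp [Matrix.mul_apply, pow_succ]
    ring

theorem geom_sum_eq_zero_of_pow_eq_one {K : Type*} [Field K] {x : K} {n : ℕ} (hx : x ≠ 1)
    (h : x ^ n = 1) : ∑ i ∈ Finset.range n, x ^ i = 0 := by
  rw [geom_sum_eq hx, h, sub_self, zero_div]

theorem reflA_pow_eq_one {K : Type*} [Field K] {u : Kˣ} (hu : u ≠ 1) {n : ℕ} (hn : u ^ n = 1) :
    reflA u ^ n = 1 := by
  have hn' : (u : K) ^ n = 1 := by
    rw [← Units.val_pow_eq_pow_val, hn, Units.val_one]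
  apply Units.ext
  rw [reflA_pow, geom_sum_eq_zero_of_pow_eq_one (by simpa using hu) hn', hn']
  exact one_fin_two.symm

theorem reflB_pow_eq_one {K : Type*} [Field K] {v : Kˣ} {y : K} (hv : v ≠ 1) {n : ℕ}
    (hn : v ^ n = 1) : reflB v y ^ n = 1 := by
  have hn' : (v : K) ^ n = 1 := by
    rw [← Units.val_pow_eq_pow_val, hn, Units.val_one]
  apply Units.ext
  rw [reflB_pow, geom_sum_eq_zero_of_pow_eq_one (by simpa using hv) hn', hn', zero_mul]
  exact one_fin_two.symm

/-! ### Membership in the reflection subgroup as a rank two commutator condition -/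

/-- The group `⟨reflA, reflB⟩` in the model of the monodromy group. -/
noncomputable abbrev gaussGroup (α β γ₁ γ₂ : ℂˣ) : Subgroup (GL (Fin 2) ℂ) :=
  reflGroup γ₁⁻¹ γ₂⁻¹ (offDiag α β)

/-- The action of pairs of elements of `gaussGroup` on `2 × 2` matrices. -/
noncomputable def gaussSandwich (α β γ₁ γ₂ : ℂˣ) :
    gaussGroup α β γ₁ γ₂ × gaussGroup α β γ₁ γ₂ →* Equiv.Perm (Matrix (Fin 2) (Fin 2) ℂ) :=
  sandwich.comp ((gaussGroup α β γ₁ γ₂).subtype.prodMap (gaussGroup α β γ₁ γ₂).subtype)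

/-- `reflA` as an element of `gaussGroup`. -/
noncomputable def gaussA (α β γ₁ γ₂ : ℂˣ) : gaussGroup α β γ₁ γ₂ :=
  ⟨reflA γ₁⁻¹, reflA_mem _ _ _⟩

/-- `reflB` as an element of `gaussGroup`. -/
noncomputable def gaussB (α β γ₁ γ₂ : ℂˣ) : gaussGroup α β γ₁ γ₂ :=
  ⟨reflB γ₂⁻¹ (offDiag α β), reflB_mem _ _ _⟩

theorem closure_gaussA_gaussB :
    Subgroup.closure {gaussA α β γ₁ γ₂, gaussB α β γ₁ γ₂} = ⊤ := by
  apply Subgroup.map_injective (gaussGroup α β γ₁ γ₂).subtype_injective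
  rw [MonoidHom.map_closure, Set.image_pair, ← MonoidHom.range_eq_map, Subgroup.range_subtype]
  rfl

theorem negAdj_mul_gaussSandwich (x y : gaussGroup α β γ₁ γ₂) :
    negAdj * gaussSandwich α β γ₁ γ₂ (x, y) = gaussSandwich α β γ₁ γ₂ (y, x) * negAdj :=
  negAdj_mul_sandwich _ _

theorem map_matAction_Mon (h : γ₁ * γ₂ = α * β) (hfin : FiniteIrreducible (Mon α β γ₁ γ₂)) :
    (Mon α β γ₁ γ₂).map (matAction h hfin) =
      swapGroup (gaussSandwich α β γ₁ γ₂) negAdj (gaussA α β γ₁ γ₂) (gaussB α β γ₁ γ₂) := by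
  rw [Mon, MonoidHom.map_closure, Set.image_insert_eq, Set.image_pair, matAction_M0, matAction_M1,
    matAction_M2]
  rfl

theorem map_matAction_Ref (h : γ₁ * γ₂ = α * β) (hfin : FiniteIrreducible (Mon α β γ₁ γ₂)) :
    (Ref α β γ₁ γ₂).map (matAction h hfin) =
      swapNormal (gaussSandwich α β γ₁ γ₂) negAdj (gaussA α β γ₁ γ₂) (gaussB α β γ₁ γ₂) := by
  rw [Ref, MonoidHom.map_closure, swapNormal, ← map_matAction_Mon h hfin]
  congr 1
  ext x
  constructor
  · rintro ⟨_, ⟨g, hg, rfl⟩, rfl⟩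
    exact ⟨_, Subgroup.mem_map_of_mem _ hg, by rw [map_mul, map_mul, map_inv, matAction_M0]⟩
  · rintro ⟨_, ⟨g, hg, rfl⟩, rfl⟩
    exact ⟨_, ⟨g, hg, rfl⟩, by rw [map_mul, map_mul, map_inv, matAction_M0]⟩

/-- The element g is recovered from its left multiplication by evaluating at 1, so the group embeds
into the transported monodromy group. -/
theorem finite_gaussGroup (h : γ₁ * γ₂ = α * β) (hfin : FiniteIrreducible (Mon α β γ₁ γ₂)) :
    Finite (gaussGroup α β γ₁ γ₂) := by
  have := hfin.1
  have hf : Finite ((Mon α β γ₁ γ₂).map (matAction h hfin)) :=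
    Finite.of_surjective _ ((matAction h hfin).subgroupMap_surjective (Mon α β γ₁ γ₂))
  rw [map_matAction_Mon] at hf
  refine Finite.of_injective (fun g => (⟨gaussSandwich α β γ₁ γ₂ (g, 1),
    map_prod_one_mem_swapGroup negAdj_mul_self negAdj_mul_gaussSandwich closure_gaussA_gaussB g⟩ :
    swapGroup (gaussSandwich α β γ₁ γ₂) negAdj (gaussA α β γ₁ γ₂) (gaussB α β γ₁ γ₂))) ?_
  intro g g' hgg
  have h1 := congrArg (fun P : Equiv.Perm _ => P 1) (Subtype.ext_iff.1 hgg)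
  have h2 : ∀ g : gaussGroup α β γ₁ γ₂, gaussSandwich α β γ₁ γ₂ (g, 1) 1 = g.1.val := by
    intro g
    change sandwich (g.1, 1) 1 = _
    simp
  simp only [h2] at h1
  exact Subtype.ext (Units.ext h1)

/-- The group `Ref ∩ ⟨M₁, M₂⟩` in terms of the commutator subgroup of `gaussGroup`. -/
theorem M1_zpow_mul_M2_zpow_mem_Ref_iff (h : γ₁ * γ₂ = α * β)
    (hfin : FiniteIrreducible (Mon α β γ₁ γ₂)) (i j : ℤ) :
    M1 γ₁ ^ i * M2 γ₂ ^ j ∈ Ref α β γ₁ γ₂ ↔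
      reflA γ₁⁻¹ ^ i * reflB γ₂⁻¹ (offDiag α β) ^ j ∈
        ⁅gaussGroup α β γ₁ γ₂, gaussGroup α β γ₁ γ₂⁆ := by
  rw [← Subgroup.mem_map_iff_mem (matAction_injective h hfin), map_matAction_Ref,
    matAction_M1_zpow_mul_M2_zpow, ← Subgroup.map_subtype_commutator]
  have e1 : sandwich (reflA γ₁⁻¹ ^ i, reflB γ₂⁻¹ (offDiag α β) ^ j) = gaussSandwich α β γ₁ γ₂
      (gaussA α β γ₁ γ₂ ^ i, gaussB α β γ₁ γ₂ ^ j) := rfl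
  have e2 : reflA γ₁⁻¹ ^ i * reflB γ₂⁻¹ (offDiag α β) ^ j = (gaussGroup α β γ₁ γ₂).subtype
      (gaussA α β γ₁ γ₂ ^ i * gaussB α β γ₁ γ₂ ^ j) := rfl
  rw [e1, e2, Subgroup.mem_map_iff_mem (gaussGroup α β γ₁ γ₂).subtype_injective]
  constructor
  · intro hm
    have := mul_mem_ker_of_mem_swapNormal (Abelianization.of) negAdj_mul_self
      negAdj_mul_gaussSandwich
      (fun x y hxy => Subtype.ext (mul_eq_one_of_sandwich_eq_one hxy))
      (fun x y => sandwich_ne_negAdj _ _) hm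
    rwa [← MonoidHom.mem_ker, Abelianization.ker_of] at this
  · exact mem_swapNormal_of_mul_mem_commutator negAdj_mul_self
      negAdj_mul_gaussSandwich closure_gaussA_gaussB

theorem commute_M1_M2 (h : γ₁ * γ₂ = α * β) (hfin : FiniteIrreducible (Mon α β γ₁ γ₂)) :
    Commute (M1 γ₁) (M2 γ₂) := by
  apply matAction_injective h hfin
  rw [map_mul, map_mul, matAction_M1, matAction_M2, ← map_mul, ← map_mul]
  simp

theorem exists_zpow_of_mem_Loc (h : γ₁ * γ₂ = α * β)
    (hfin : FiniteIrreducible (Mon α β γ₁ γ₂)) {g : GL (Fin 4) ℂ} (hg : g ∈ Loc γ₁ γ₂) :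
    ∃ i j : ℤ, g = M1 γ₁ ^ i * M2 γ₂ ^ j := by
  have hc := commute_M1_M2 h hfin
  refine Subgroup.closure_induction ?_ ⟨0, 0, by simp⟩ ?_ ?_ hg
  · rintro x (rfl | rfl)
    · exact ⟨1, 0, by simp⟩
    · exact ⟨0, 1, by simp⟩
  · rintro _ _ - - ⟨i, j, rfl⟩ ⟨k, l, rfl⟩
    refine ⟨i + k, j + l, ?_⟩
    rw [_root_.zpow_add, _root_.zpow_add]
    exact ((hc.zpow_zpow k j).symm).mul_mul_mul_comm _ _
  · rintro _ - ⟨i, j, rfl⟩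
    exact ⟨-i, -j, by rw [_root_.mul_inv_rev, _root_.zpow_neg, _root_.zpow_neg,
      ((hc.zpow_zpow i j).inv_inv).eq]⟩

theorem M1_mem_Loc : M1 γ₁ ∈ Loc γ₁ γ₂ := Subgroup.subset_closure (by simp)

theorem M2_mem_Loc : M2 γ₂ ∈ Loc γ₁ γ₂ := Subgroup.subset_closure (by simp)

theorem M1_pow_eq_one (h : γ₁ * γ₂ = α * β) (hfin : FiniteIrreducible (Mon α β γ₁ γ₂))
    (h1 : γ₁ ≠ 1) {n : ℕ} (hn : γ₁ ^ n = 1) : M1 γ₁ ^ n = 1 := by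
  apply matAction_injective h hfin
  rw [map_pow, matAction_M1, map_one, ← map_pow, Prod.pow_mk, one_pow,
    reflA_pow_eq_one (by simpa using h1) (by rw [inv_pow, hn, inv_one])]
  exact map_one _

theorem M2_pow_eq_one (h : γ₁ * γ₂ = α * β) (hfin : FiniteIrreducible (Mon α β γ₁ γ₂))
    (h2 : γ₂ ≠ 1) {n : ℕ} (hn : γ₂ ^ n = 1) : M2 γ₂ ^ n = 1 := by
  apply matAction_injective h hfin
  rw [map_pow, matAction_M2, map_one, ← map_pow, Prod.pow_mk, one_pow,
    reflB_pow_eq_one (by simpa using h2) (by rw [inv_pow, hn, inv_one])]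
  exact map_one _

theorem zpow_eq_one_of_mem_commutator {u v : ℂˣ} {y : ℂ} {i j : ℤ}
    (hm : reflA u ^ i * reflB v y ^ j ∈ ⁅reflGroup u v y, reflGroup u v y⁆) :
    u ^ i * v ^ j = 1 := by
  have := det_eq_one_of_mem_commutator hm
  simpa using this

/-! ### Reduction modulo two -/

/-- `R` is the ring of all algebraic integers and `k` its residue field at a maximal ideal
containing 2. Such an ideal exists because 1/2 is not integral. -/
theorem exists_ringHom_two_eq_zero :
    ∃ (R k : Type) (_ : CommRing R) (_ : Field k) (ι : R →+* ℂ) (_ : R →+* k),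
      Function.Injective ι ∧ (∀ x, IsIntegral ℤ x → ∃ r, ι r = x) ∧ (2 : k) = 0 := by
  have h2 : Ideal.span {(2 : integralClosure ℤ ℂ)} ≠ ⊤ := by
    rw [Ne, Ideal.span_singleton_eq_top]
    intro hu
    obtain ⟨x, hx⟩ := hu.exists_right_inv
    have hx' : algebraMap ℚ ℂ (1 / 2) = (x : ℂ) := by
      have := congrArg (algebraMap (integralClosure ℤ ℂ) ℂ) hx
      simp at this
      have h3 : (2 : ℂ) * x = 1 := this
      rw [map_div₀, map_one, map_ofNat]
      field_simp
      exact h3.symm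
    have hi : IsIntegral ℤ (1 / 2 : ℚ) := by
      have hi : IsIntegral ℤ (algebraMap ℚ ℂ (1 / 2)) := hx' ▸ x.2
      exact (isIntegral_algebraMap_iff (algebraMap ℚ ℂ).injective).1 hi
    obtain ⟨z, hz⟩ := IsIntegrallyClosed.isIntegral_iff.1 hi
    have hz' : (z : ℚ) = 1 / 2 := hz
    have : (2 * z : ℤ) = 1 := by
      have : (2 * z : ℚ) = 1 := by rw [hz']; norm_num
      exact_mod_cast this
    omega
  obtain ⟨m, hm, hle⟩ := Ideal.exists_le_maximal _ h2
  refine ⟨integralClosure ℤ ℂ, integralClosure ℤ ℂ ⧸ m, inferInstance, Ideal.Quotient.field m,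
    algebraMap _ _, Ideal.Quotient.mk m, Subtype.val_injective, fun x hx => ⟨⟨x, hx⟩, rfl⟩, ?_⟩
  have : Ideal.Quotient.mk m 2 = 0 :=
    Ideal.Quotient.eq_zero_iff_mem.2 (hle (Ideal.mem_span_singleton_self 2))
  exact (map_ofNat (Ideal.Quotient.mk m) 2).symm.trans this

theorem map_injective_of_injective {R S : Type*} [CommRing R] [CommRing S] {f : R →+* S}
    (hf : Function.Injective f) :
    Function.Injective (GeneralLinearGroup.map (n := Fin 2) f) := by
  intro g h hgh
  ext i j
  apply hf
  have := congrArg (fun x : GL (Fin 2) S => x.val i j) hgh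
  simpa using this

theorem map_mem_commutator {R S : Type*} [CommRing R] [CommRing S] (f : R →+* S) {u v : Rˣ}
    {y : R} {i j : ℤ} (hm : reflA u ^ i * reflB v y ^ j ∈ ⁅reflGroup u v y, reflGroup u v y⁆) :
    reflA (Units.map (f : R →* S) u) ^ i * reflB (Units.map (f : R →* S) v) (f y) ^ j ∈
      ⁅reflGroup (Units.map (f : R →* S) u) (Units.map (f : R →* S) v) (f y),
        reflGroup (Units.map (f : R →* S) u) (Units.map (f : R →* S) v) (f y)⁆ := by
  have := Subgroup.mem_map_of_mem (GeneralLinearGroup.map f) hm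
  rw [map_commutator_reflGroup] at this
  simpa using this

theorem mem_commutator_of_map {R S : Type*} [CommRing R] [CommRing S] {f : R →+* S}
    (hf : Function.Injective f) {u v : Rˣ} {y : R} {i j : ℤ}
    (hm : reflA (Units.map (f : R →* S) u) ^ i * reflB (Units.map (f : R →* S) v) (f y) ^ j ∈
      ⁅reflGroup (Units.map (f : R →* S) u) (Units.map (f : R →* S) v) (f y),
        reflGroup (Units.map (f : R →* S) u) (Units.map (f : R →* S) v) (f y)⁆) :
    reflA u ^ i * reflB v y ^ j ∈ ⁅reflGroup u v y, reflGroup u v y⁆ := by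
  rw [← map_commutator_reflGroup, ← map_reflA, ← map_reflB, ← map_zpow, ← map_zpow,
    ← map_mul] at hm
  exact (Subgroup.mem_map_iff_mem (map_injective_of_injective hf)).1 hm

/-- Membership of `reflA ^ i * reflB ^ j` in the commutator subgroup is preserved by the reduction
of the entries modulo two. -/
theorem exists_reduction {u v : ℂˣ} {y : ℂ} {n : ℕ} (hn : n ≠ 0) (hu : u ^ n = 1)
    (hv : v ^ n = 1) (hy : IsIntegral ℤ y) {i j : ℤ}
    (hm : reflA u ^ i * reflB v y ^ j ∈ ⁅reflGroup u v y, reflGroup u v y⁆) :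
    ∃ (R k : Type) (_ : CommRing R) (_ : Field k) (ι : R →+* ℂ) (φ : R →+* k) (u₀ v₀ y₀ : R)
      (U V : kˣ), Function.Injective ι ∧ (2 : k) = 0 ∧ ι u₀ = u ∧ ι v₀ = v ∧ ι y₀ = y ∧
      (U : k) = φ u₀ ∧ (V : k) = φ v₀ ∧
      reflA U ^ i * reflB V (φ y₀) ^ j ∈ ⁅reflGroup U V (φ y₀), reflGroup U V (φ y₀)⁆ := by
  obtain ⟨R, k, _, _, ι, φ, hι, hR, h2⟩ := exists_ringHom_two_eq_zero
  have hint : ∀ x : ℂˣ, x ^ n = 1 → ∃ x₀ : Rˣ, Units.map (ι : R →* ℂ) x₀ = x := by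
    intro x hx
    have hx' : (x : ℂ) ^ n = 1 := by rw [← Units.val_pow_eq_pow_val, hx, Units.val_one]
    have hi : IsIntegral ℤ (x : ℂ) :=
      IsIntegral.of_pow (Nat.pos_of_ne_zero hn) (hx' ▸ isIntegral_one)
    obtain ⟨r, hr⟩ := hR x hi
    refine ⟨Units.ofPowEqOne r n (hι ?_) hn, ?_⟩
    · rw [map_pow, hr, hx', map_one]
    · ext
      exact hr
  obtain ⟨u₀, hu₀⟩ := hint u hu
  obtain ⟨v₀, hv₀⟩ := hint v hv
  obtain ⟨y₀, hy₀⟩ := hR y hy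
  refine ⟨R, k, _, _, ι, φ, u₀, v₀, y₀, Units.map (φ : R →* k) u₀, Units.map (φ : R →* k) v₀,
    hι, h2, congrArg Units.val hu₀, congrArg Units.val hv₀, hy₀, rfl, rfl,
    map_mem_commutator φ (mem_commutator_of_map hι ?_)⟩
  rw [hu₀, hv₀, hy₀]
  exact hm

theorem zpow_smul_eq {K : Type*} [Field K] {g : GL (Fin 2) K} {w : Fin 2 → K} {c : Kˣ}
    (h : g • w = c • w) (i : ℤ) : g ^ i • w = c ^ i • w := by
  have hnat : ∀ n : ℕ, g ^ n • w = c ^ n • w := by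
    intro n
    induction n with
    | zero => simp
    | succ n ih => rw [pow_succ, mul_smul, h, smul_comm, ih, smul_smul, pow_succ']
  cases i with
  | ofNat n => simpa using hnat n
  | negSucc n =>
    rw [zpow_negSucc, zpow_negSucc, inv_smul_eq_iff, smul_comm, hnat, inv_smul_smul]

/-- The group acts on the line of `w` through a character, which is trivial on commutators and takes
the value uⁱ on the given element. -/
theorem pow_eq_one_of_common_eigenvector {K : Type*} [Field K] {u v : Kˣ} {y : K} {w : Fin 2 → K}
    (hw : w ≠ 0) (hA : reflA u • w = u • w) (hB : reflB v y • w = w) {i j : ℤ}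
    (hm : reflA u ^ i * reflB v y ^ j ∈ ⁅reflGroup u v y, reflGroup u v y⁆) : u ^ i = 1 := by
  have heig : ∀ g ∈ reflGroup u v y, ∃ c : Kˣ, g • w = c • w := by
    intro g hg
    refine Subgroup.closure_induction ?_ ⟨1, by simp⟩ ?_ ?_ hg
    · rintro x (rfl | rfl)
      · exact ⟨u, hA⟩
      · exact ⟨1, by rw [hB, one_smul]⟩
    · rintro g h - - ⟨c, hc⟩ ⟨d, hd⟩
      exact ⟨d * c, by rw [mul_smul, hd, smul_comm, hc, smul_smul]⟩
    · rintro g - ⟨c, hc⟩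
      exact ⟨c⁻¹, by rw [inv_smul_eq_iff, smul_comm, hc, inv_smul_smul]⟩
  have hle : ⁅reflGroup u v y, reflGroup u v y⁆ ≤ MulAction.stabilizer (GL (Fin 2) K) w := by
    rw [Subgroup.commutator_le]
    intro g hg h hh
    obtain ⟨c, hc⟩ := heig g hg
    obtain ⟨d, hd⟩ := heig h hh
    have hc' : g⁻¹ • w = c⁻¹ • w := by rw [inv_smul_eq_iff, smul_comm, hc, inv_smul_smul]
    have hd' : h⁻¹ • w = d⁻¹ • w := by rw [inv_smul_eq_iff, smul_comm, hd, inv_smul_smul]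
    rw [MulAction.mem_stabilizer_iff, commutatorElement_def, mul_smul, mul_smul, mul_smul, hd',
      smul_comm g⁻¹, hc', smul_comm h, smul_comm h, hd, smul_comm g, smul_comm g, smul_comm g, hc,
      smul_smul, smul_smul, smul_smul, mul_comm d⁻¹, inv_mul_cancel_right, inv_mul_cancel, one_smul]
  have h1 := hle hm
  rw [MulAction.mem_stabilizer_iff, mul_smul,
    zpow_smul_eq (c := 1) (hB.trans (one_smul _ _).symm), _root_.one_zpow, one_smul, zpow_smul_eq hA] at h1
  obtain ⟨x, hx⟩ := Function.ne_iff.1 hw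
  have h2 := congrFun h1 x
  ext
  rw [Pi.smul_apply, Units.smul_def, smul_eq_mul] at h2
  exact mul_right_cancel₀ hx (h2.trans (one_mul _).symm)

/-- The sign of the permutation of the plane over `𝔽₂`. -/
noncomputable def signHom : GL (Fin 2) (ZMod 2) →* ℤˣ :=
  Equiv.Perm.sign.comp (MulAction.toPermHom (GL (Fin 2) (ZMod 2)) (Fin 2 → ZMod 2))

theorem signHom_reflA : signHom (reflA 1) = -1 := by
  decide +kernel

theorem signHom_reflB : signHom (reflB 1 1) = -1 := by
  decide +kernel

/-- The matrices are defined over 𝔽₂, where both are transvections, hence odd permutations of the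
plane; commutators are even. -/
theorem even_add_of_mem_commutator {k : Type*} [Field k] (h2 : (2 : k) = 0) {i j : ℤ}
    (hm : reflA (1 : kˣ) ^ i * reflB (1 : kˣ) 1 ^ j ∈
      ⁅reflGroup (1 : kˣ) 1 1, reflGroup (1 : kˣ) 1 1⁆) : Even (i + j) := by
  have : CharP k 2 := CharTwo.of_one_ne_zero_of_two_eq_zero one_ne_zero h2
  have hm' : reflA (1 : (ZMod 2)ˣ) ^ i * reflB (1 : (ZMod 2)ˣ) 1 ^ j ∈
      ⁅reflGroup (1 : (ZMod 2)ˣ) 1 1, reflGroup (1 : (ZMod 2)ˣ) 1 1⁆ := by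
    apply mem_commutator_of_map (f := ZMod.castHom (dvd_refl 2) k) (ZMod.castHom_injective k)
    rw [map_one, map_one]
    exact hm
  have h1 : ⁅reflGroup (1 : (ZMod 2)ˣ) 1 1, reflGroup (1 : (ZMod 2)ˣ) 1 1⁆ ≤
      commutator (GL (Fin 2) (ZMod 2)) := by
    rw [commutator_def]
    exact Subgroup.commutator_mono le_top le_top
  have h3 : signHom _ = 1 := Abelianization.commutator_subset_ker signHom (h1 hm')
  rw [map_mul, map_zpow, map_zpow, signHom_reflA, signHom_reflB, ← _root_.zpow_add] at h3
  by_contra ho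
  rw [Int.not_even_iff_odd] at ho
  rw [ho.neg_one_zpow] at h3
  exact absurd h3 (by decide)

open scoped commutatorElement

theorem coe_cube_root_relation {x : ℂˣ} (hx : IsPrimitiveRoot x 3) :
    (x : ℂ) ^ 2 + x + 1 = 0 := by
  have h := geom_sum_eq_zero_of_pow_eq_one (x := (x : ℂ)) (n := 3)
    (by simpa using hx.ne_one (by norm_num))
    (by rw [← Units.val_pow_eq_pow_val, hx.pow_eq_one, Units.val_one])
  simp [Finset.sum_range_succ] at h
  linear_combination h

theorem coe_fifth_root_relation {x : ℂˣ} (hx : IsPrimitiveRoot x 5) :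
    (x : ℂ) ^ 4 + x ^ 3 + x ^ 2 + x + 1 = 0 := by
  have h := geom_sum_eq_zero_of_pow_eq_one (x := (x : ℂ)) (n := 5)
    (by simpa using hx.ne_one (by norm_num))
    (by rw [← Units.val_pow_eq_pow_val, hx.pow_eq_one, Units.val_one])
  simp [Finset.sum_range_succ] at h
  linear_combination h

/-! ### The commutator quotient of the rank two groups -/

/-- Modulo 2 the vector (1, u²) is fixed by B and scaled by u under A. The reduction of u still has
order 3, since 3 ≠ 0 in characteristic 2, so triviality of uⁱ lifts back. -/
theorem zpow_eq_one_of_primitive_cube_root {u : ℂˣ} (hu : (u : ℂ) ^ 2 + u + 1 = 0) {i j : ℤ}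
    (hm : reflA u ^ i * reflB u u ^ j ∈ ⁅reflGroup u u (u : ℂ), reflGroup u u (u : ℂ)⁆) :
    u ^ i = 1 := by
  have hu3 : u ^ 3 = 1 := by
    ext
    push_cast
    linear_combination (u - 1 : ℂ) * hu
  have hint : IsIntegral ℤ (u : ℂ) := by
    refine IsIntegral.of_pow (n := 3) (by norm_num) ?_
    rw [← Units.val_pow_eq_pow_val, hu3, Units.val_one]
    exact isIntegral_one
  obtain ⟨R, k, _, _, ι, φ, u₀, v₀, y₀, U, V, hι, h2, hu₀, hv₀, hy₀, hU, hV, hm⟩ :=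
    exists_reduction (n := 3) (by norm_num) hu3 hu3 hint hm
  have hvu : v₀ = u₀ := hι (hv₀.trans hu₀.symm)
  have hyu : y₀ = u₀ := hι (hy₀.trans hu₀.symm)
  subst hvu hyu
  have hVU : V = U := Units.ext (hV.trans hU.symm)
  subst hVU
  rw [← hU] at hm
  have hrel : (V : k) ^ 2 + V + 1 = 0 := by
    have : y₀ ^ 2 + y₀ + 1 = 0 := hι (by simp [hu₀, hu])
    have := congrArg φ this
    simpa [← hU] using this
  have hV3 : V ^ 3 = 1 := by
    ext
    push_cast
    linear_combination (V - 1 : k) * hrel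
  have h1 : V ^ i = 1 := by
    refine pow_eq_one_of_common_eigenvector (w := ![1, (V : k) ^ 2]) ?_ ?_ ?_ hm
    · intro h
      simpa using congrFun h 0
    · rw [GeneralLinearGroup.fin_two_smul]
      ext x
      fin_cases x
      · simp [Units.smul_def]
        linear_combination hrel - V * h2
      · simp [Units.smul_def]
    · rw [GeneralLinearGroup.fin_two_smul]
      ext x
      fin_cases x
      · simp
      · simp
        linear_combination V * hrel - V ^ 2 * h2
  have h3 : i % 3 = 0 ∨ i % 3 = 1 ∨ i % 3 = 2 := by omega
  have hred : ∀ {G : Type} [Group G] (x : G), x ^ 3 = 1 → x ^ i = x ^ (i % 3) := by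
    intro G _ x hx
    conv_lhs => rw [← Int.emod_add_mul_ediv i 3]
    rw [_root_.zpow_add, _root_.zpow_mul, zpow_ofNat, hx, _root_.one_zpow, mul_one]
  have hV1 : V ≠ 1 := by
    rintro rfl
    have : (1 : k) = 0 := by
      simp only [Units.val_one] at hrel
      linear_combination hrel - h2
    exact one_ne_zero this
  rw [hred u hu3]
  rw [hred V hV3] at h1
  rcases h3 with h | h | h
  · rw [h, _root_.zpow_zero]
  · rw [h, _root_.zpow_one] at h1
    exact absurd h1 hV1
  · rw [h] at h1
    exfalso
    apply hV1
    have h2 : V ^ 2 = 1 := by exact_mod_cast h1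
    rw [pow_succ, h2, one_mul] at hV3
    exact hV3

/-- Modulo 2 the equations u² = -1, v = -1 and (y + 1 - u)² = -u all collapse to u = v = y = 1,
where the sign character applies. -/
theorem even_add_of_order_four {u v : ℂˣ} {y t : ℂ} (hu : (u : ℂ) ^ 2 = -1) (hv : (v : ℂ) = -1)
    (ht : t ^ 2 = -u) (hy : y = t - 1 + u) {i j : ℤ}
    (hm : reflA u ^ i * reflB v y ^ j ∈ ⁅reflGroup u v y, reflGroup u v y⁆) : Even (i + j) := by
  have hu4 : u ^ 4 = 1 := by
    ext
    push_cast
    linear_combination ((u : ℂ) ^ 2 - 1) * hu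
  have hv4 : v ^ 4 = 1 := by
    ext
    push_cast
    rw [hv]
    norm_num
  have hui : IsIntegral ℤ (u : ℂ) := by
    refine IsIntegral.of_pow (n := 4) (by norm_num) ?_
    rw [← Units.val_pow_eq_pow_val, hu4, Units.val_one]
    exact isIntegral_one
  have hti : IsIntegral ℤ t := IsIntegral.of_pow (n := 2) (by norm_num) (ht ▸ hui.neg)
  have hint : IsIntegral ℤ y := hy ▸ (hti.sub isIntegral_one).add hui
  obtain ⟨R, k, _, _, ι, φ, u₀, v₀, y₀, U, V, hι, h2, hu₀, hv₀, hy₀, hU, hV, hm⟩ :=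
    exists_reduction (n := 4) (by norm_num) hu4 hv4 hint hm
  have hV1 : V = 1 := by
    have : v₀ = -1 := hι (by simp [hv₀, hv])
    ext
    rw [hV, this, map_neg, map_one, Units.val_one]
    linear_combination -h2
  have hU1 : U = 1 := by
    have : u₀ ^ 2 = -1 := hι (by simp [hu₀, hu])
    have h := congrArg φ this
    rw [map_pow, map_neg, map_one, ← hU] at h
    have h0 : ((U : k) - 1) ^ 2 = 0 := by linear_combination h - U * h2
    ext
    exact sub_eq_zero.1 (pow_eq_zero_iff two_ne_zero |>.1 h0)
  have hY1 : φ y₀ = 1 := by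
    have : (y₀ + 1 - u₀) ^ 2 = -u₀ := hι (by
      simp only [map_pow, map_sub, map_add, map_one, map_neg, hu₀, hy₀, hy, ← ht]
      ring)
    have h := congrArg φ this
    rw [map_pow, map_sub, map_add, map_one, map_neg, ← hU, hU1, Units.val_one] at h
    have h0 : (φ y₀ - 1) ^ 2 = 0 := by linear_combination h - φ y₀ * h2
    exact sub_eq_zero.1 (pow_eq_zero_iff two_ne_zero |>.1 h0)
  rw [hV1, hU1, hY1] at hm
  exact even_add_of_mem_commutator h2 hm

theorem mul_inv_mem_commutator_of_braid {G : Type*} [Group G] {Γ : Subgroup G} {a b c : G}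
    (ha : a ∈ Γ) {g : G} (hg : g ∈ Γ) (hc : c = g * a * g⁻¹) (hb : b = c⁻¹) : a * b ∈ ⁅Γ, Γ⁆ := by
  have : a * b = ⁅a, g⁆ := by
    rw [hb, hc, commutatorElement_def]
    group
  rw [this]
  exact Subgroup.commutator_mem_commutator ha hg

theorem eq_conj_of_braid {G : Type*} [Group G] {a c : G} (h : a * c * a = c * a * c) :
    c = (a * c) * a * (a * c)⁻¹ := by
  rw [h]
  group

/-- Both matrices have eigenvalues 1 and v. The braid relation reduces to the single condition
tr(ac) = v. -/
theorem braid_of_val {R : Type*} [CommRing R] {a c : GL (Fin 2) R} {p y v : R}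
    (ha : a.val = !![1, p; 0, v]) (hc : c.val = !![1, 0; y, v]) (h : 1 + p * y + v ^ 2 = v) :
    a * c * a = c * a * c := by
  apply Units.ext
  simp only [Units.val_mul, ha, hc]
  ext i j
  fin_cases i <;> fin_cases j <;> simp [Matrix.mul_apply]
  · linear_combination p * h
  · linear_combination -y * h
  · ring

/-- B⁻¹ has the same eigenvalues as A, and the trace condition 1 + 2u + u² = u for the braid
relation is the cyclotomic equation. -/
theorem mul_mem_commutator_of_cube_root {u v : ℂˣ} (hu : (u : ℂ) ^ 2 + u + 1 = 0)
    (huv : u * v = 1) {y : ℂ} (hy : y = -2) :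
    reflA u * reflB v y ∈ ⁅reflGroup u v y, reflGroup u v y⁆ := by
  have hv : v⁻¹ = u := inv_eq_of_mul_eq_one_left huv
  have hbr : reflA u * (reflB v y)⁻¹ * reflA u = (reflB v y)⁻¹ * reflA u * (reflB v y)⁻¹ := by
    refine braid_of_val (p := 1) (y := 2 * u) (v := u) rfl ?_ ?_
    · change !![1, 0; -(((v⁻¹ : ℂˣ) : ℂ) * y), ((v⁻¹ : ℂˣ) : ℂ)] = _
      rw [hv, hy]
      ext i j
      fin_cases i <;> fin_cases j <;> simp [mul_comm]
    · linear_combination hu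
  exact mul_inv_mem_commutator_of_braid (reflA_mem _ _ _)
    (mul_mem (reflA_mem _ _ _) (inv_mem (reflB_mem _ _ _))) (eq_conj_of_braid hbr)
    (inv_inv _).symm

theorem zpow_eq_one_of_units_zpow_eq_one {K : Type*} [Field K] {v : Kˣ} {y : K} (hv : v ≠ 1)
    {n : ℤ} (hn : v ^ n = 1) : reflB v y ^ n = 1 := by
  obtain ⟨m, rfl | rfl⟩ := n.eq_nat_or_neg
  · rw [zpow_natCast] at hn ⊢
    exact reflB_pow_eq_one hv hn
  · rw [_root_.zpow_neg, inv_eq_one, zpow_natCast] at hn ⊢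
    exact reflB_pow_eq_one hv hn

/-- Here v³ = u, so B³ is the power of B with the eigenvalues of A. It satisfies the braid relation
with A and equals B⁻ʲ. -/
theorem mul_zpow_mem_commutator_of_eq_sq {u v : ℂˣ}
    (hu : (u : ℂ) ^ 4 + u ^ 3 + u ^ 2 + u + 1 = 0) (hv1 : v ≠ 1) (hv : v = u ^ 2)
    {y : ℂ} (hy : y = -1 - u * v) {j : ℤ} (hj : u * v ^ j = 1) :
    reflA u * reflB v y ^ j ∈ ⁅reflGroup u v y, reflGroup u v y⁆ := by
  have hu5 : u ^ 5 = 1 := by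
    ext
    push_cast
    linear_combination (u - 1 : ℂ) * hu
  have hv3 : v ^ 3 = u := by rw [hv, ← pow_mul, pow_succ, hu5, one_mul]
  have hbr : reflA u * reflB v y ^ 3 * reflA u = reflB v y ^ 3 * reflA u * reflB v y ^ 3 := by
    refine braid_of_val (p := 1) (y := (1 + v + v ^ 2) * y) (v := u) rfl ?_ ?_
    · rw [reflB_pow, ← Units.val_pow_eq_pow_val, hv3]
      simp [Finset.sum_range_succ]
    · rw [hy, hv]
      push_cast
      linear_combination (-u * (u ^ 2 - u + 1) : ℂ) * hu
  refine mul_inv_mem_commutator_of_braid (reflA_mem _ _ _)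
    (mul_mem (reflA_mem u v y) (pow_mem (reflB_mem u v y) 3)) (eq_conj_of_braid hbr) ?_
  rw [eq_inv_iff_mul_eq_one, ← zpow_natCast, ← _root_.zpow_add]
  apply zpow_eq_one_of_units_zpow_eq_one hv1
  rw [_root_.zpow_add, zpow_natCast, hv3, mul_comm, hj]

/-- Here the braid relation holds between A³ and B. Squaring the resulting conjugacy gives B²
conjugate to A⁶ = A, and B² = B⁻ʲ. -/
theorem mul_zpow_mem_commutator_of_eq_cube {u v : ℂˣ}
    (hu : (u : ℂ) ^ 4 + u ^ 3 + u ^ 2 + u + 1 = 0) (hu1 : u ≠ 1) (hv1 : v ≠ 1) (hv : v = u ^ 3)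
    {y : ℂ} (hy : y = -1 - u * v) {j : ℤ} (hj : u * v ^ j = 1) :
    reflA u * reflB v y ^ j ∈ ⁅reflGroup u v y, reflGroup u v y⁆ := by
  have hu5 : u ^ 5 = 1 := by
    ext
    push_cast
    linear_combination (u - 1 : ℂ) * hu
  have hv2 : v ^ 2 = u := by rw [hv, ← pow_mul, pow_succ, hu5, one_mul]
  have hbr : reflA u ^ 3 * reflB v y * reflA u ^ 3 = reflB v y * reflA u ^ 3 * reflB v y := by
    refine braid_of_val (p := 1 + u + u ^ 2) (y := y) (v := v) ?_ rfl ?_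
    · rw [reflA_pow, ← Units.val_pow_eq_pow_val, ← hv]
      simp [Finset.sum_range_succ]
    · rw [hy, hv]
      push_cast
      linear_combination (-u : ℂ) * hu
  have hconj := eq_conj_of_braid hbr
  set g := reflA u ^ 3 * reflB v y
  have hg : g ∈ reflGroup u v y := mul_mem (pow_mem (reflA_mem _ _ _) 3) (reflB_mem _ _ _)
  have hB2 : reflB v y ^ 2 = g * reflA u * g⁻¹ := by
    rw [hconj, conj_pow, ← pow_mul, pow_succ _ 5, reflA_pow_eq_one hu1 hu5, one_mul]
  refine mul_inv_mem_commutator_of_braid (reflA_mem _ _ _) hg hB2 ?_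
  rw [eq_inv_iff_mul_eq_one, ← zpow_natCast, ← _root_.zpow_add]
  apply zpow_eq_one_of_units_zpow_eq_one hv1
  rw [_root_.zpow_add, zpow_natCast, hv2, mul_comm, hj]

/-! ### Restrictions on finite groups -/

theorem pow_eq_one_of_reflA_pow_mem_center {u : ℂˣ} {e : ℕ}
    (h : reflA u ^ e ∈ Subgroup.center (GL (Fin 2) ℂ)) : u ^ e = 1 := by
  obtain ⟨c, hc⟩ := GeneralLinearGroup.mem_center_iff_val_mem_range_scalar.1 h
  rw [reflA_pow] at hc
  have h0 := congrFun (congrFun hc 0) 0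
  have h1 := congrFun (congrFun hc 1) 1
  simp at h0 h1
  ext
  rw [Units.val_pow_eq_pow_val, ← h1, h0, Units.val_one]

theorem pow_eq_one_of_reflB_pow_mem_center {v : ℂˣ} {y : ℂ} {e : ℕ}
    (h : reflB v y ^ e ∈ Subgroup.center (GL (Fin 2) ℂ)) : v ^ e = 1 := by
  obtain ⟨c, hc⟩ := GeneralLinearGroup.mem_center_iff_val_mem_range_scalar.1 h
  rw [reflB_pow] at hc
  have h0 := congrFun (congrFun hc 0) 0
  have h1 := congrFun (congrFun hc 1) 1
  simp at h0 h1
  ext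
  rw [Units.val_pow_eq_pow_val, ← h1, h0, Units.val_one]

theorem det_reflA_reflB_commutator (u v : ℂˣ) (y : ℂ) :
    ((reflA u).val * (reflB v y).val - (reflB v y).val * (reflA u).val).det =
      -(y * (y + (u - 1) * (v - 1))) := by
  simp [det_fin_two]
  ring

theorem exists_pow_mem_center_of_sq_ne_one {u v : ℂˣ} {y : ℂ} [Finite (reflGroup u v y)]
    (hy : y ≠ 0) (hy' : y + (u - 1) * (v - 1) ≠ 0) (hu : u ^ 2 ≠ 1) (hv : v ^ 2 ≠ 1) :
    ∀ g ∈ reflGroup u v y, ∃ e, 1 ≤ e ∧ e ≤ 5 ∧ g ^ e ∈ Subgroup.center (GL (Fin 2) ℂ) := by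
  refine GeneralLinearGroup.exists_pow_mem_center (reflA_mem u v y) (reflB_mem u v y)
    (fun h => hu (pow_eq_one_of_reflA_pow_mem_center h))
    (fun h => hv (pow_eq_one_of_reflB_pow_mem_center h)) ?_
  rw [det_reflA_reflB_commutator]
  exact neg_ne_zero.2 (mul_ne_zero hy hy')

/-- A variant for when B may be an involution: AB serves as the second element of order at least 3
modulo scalars, its square being non-scalar because tr(AB) ≠ 0. The eigenvector condition carries
over through A(AB) - (AB)A = A(AB - BA). -/
theorem exists_pow_mem_center_of_trace_ne_zero {u v : ℂˣ} {y : ℂ} [Finite (reflGroup u v y)]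
    (hy : y ≠ 0) (hy' : y + (u - 1) * (v - 1) ≠ 0) (hu : u ^ 2 ≠ 1) (ht : 1 + y + u * v ≠ 0) :
    ∀ g ∈ reflGroup u v y, ∃ e, 1 ≤ e ∧ e ≤ 5 ∧ g ^ e ∈ Subgroup.center (GL (Fin 2) ℂ) := by
  refine GeneralLinearGroup.exists_pow_mem_center (reflA_mem u v y)
    (mul_mem (reflA_mem u v y) (reflB_mem u v y))
    (fun h => hu (pow_eq_one_of_reflA_pow_mem_center h)) (fun h => ht ?_) ?_
  · obtain ⟨c, hc⟩ := GeneralLinearGroup.mem_center_iff_val_mem_range_scalar.1 h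
    have h0 := congrFun (congrFun hc 0) 1
    simp [sq, Matrix.mul_apply] at h0
    have h1 : (1 + y + u * v) * (v : ℂ) = 0 := by linear_combination -h0
    exact (mul_eq_zero.1 h1).resolve_right v.ne_zero
  · rw [Units.val_mul, ← mul_assoc, mul_assoc _ _ (reflA u).val, mul_assoc, ← mul_sub, det_mul,
      det_reflA_reflB_commutator]
    exact mul_ne_zero (reflA u).det_ne_zero (neg_ne_zero.2 (mul_ne_zero hy hy'))

/-- Let x and x' be tr²/det for AB and A²B. Both lie in the short list of admissible values and x' =
2x; excluding tr(AB) = 0 and scalar A²B leaves x = 1. -/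
theorem sq_eq_neg_of_order_four {u v : ℂˣ} {y : ℂ} [Finite (reflGroup u v y)]
    (hy : y ≠ 0) (hy' : y + (u - 1) * (v - 1) ≠ 0) (hu : (u : ℂ) ^ 2 = -1) (hv : (v : ℂ) = -1)
    (ht : 1 + y + u * v ≠ 0) : (1 + y + u * v : ℂ) ^ 2 = -u := by
  have hu2 : u ^ 2 ≠ 1 := by
    intro h
    rw [← Units.val_pow_eq_pow_val, h, Units.val_one] at hu
    norm_num at hu
  have hall := exists_pow_mem_center_of_trace_ne_zero hy hy' hu2 ht
  have hD := mul_mem (reflA_mem u v y) (reflB_mem u v y)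
  have hAD := mul_mem (reflA_mem u v y) hD
  obtain ⟨e, h1, h5, he⟩ := hall _ hD
  obtain ⟨x, hx, hxl⟩ := GeneralLinearGroup.pow_mem_center_discr h1 h5 he
  obtain ⟨e', h1', h5', he'⟩ := hall _ hAD
  obtain ⟨x', hx', hxl'⟩ := GeneralLinearGroup.pow_mem_center_discr h1' h5' he'
  have hx0 : (1 + y + u * v : ℂ) ^ 2 = -x * u := by
    simp [trace_fin_two, det_fin_two] at hx
    linear_combination hx + x * u * hv
  -- From tr(A²B) = (1 + u) tr(AB), (1 + u)² = 2u and det(A²B) = 1.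
  have hx0' : x' = 2 * x := by
    simp [trace_fin_two, det_fin_two, hv] at hx'
    rw [hv] at hx0
    linear_combination -hx' + x' * hu + (1 + u) ^ 2 * hx0 - (x * u + 2 * x) * hu
  have hxne4 : x' ≠ 4 := by
    rintro rfl
    have hc := GeneralLinearGroup.mem_center_of_discr_eq_zero
      ((reflGroup u v y).subtype.isOfFinOrder (isOfFinOrder_of_finite (⟨_, hAD⟩ : reflGroup u v y)))
      hx'
    obtain ⟨c, hc⟩ := GeneralLinearGroup.mem_center_iff_val_mem_range_scalar.1 hc
    have h0 := congrFun (congrFun hc 1) 0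
    simp [Matrix.mul_apply, hy] at h0
  have hx1 : x = 1 := by
    subst hx0'
    rcases hxl with rfl | rfl | rfl | rfl | h
    · exfalso
      apply ht
      simpa using hx0
    · rfl
    · norm_num at hxne4
    · norm_num at hxl'
    · exfalso
      rcases hxl' with h' | h' | h' | h' | h'
      · have : x = 0 := by linear_combination h' / 2
        norm_num [this] at h
      · have : x = 1 / 2 := by linear_combination h' / 2
        norm_num [this] at h
      · have : x = 1 := by linear_combination h' / 2
        norm_num [this] at h
      · have : x = 2 := by linear_combination h' / 2
        norm_num [this] at h
      · have : x = 1 / 2 := by linear_combination h' / 6 - 2 / 3 * h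
        norm_num [this] at h
  rw [hx0, hx1]
  ring

/-- For AB⁻¹ the invariant tr²/det is ((1 + u)(1 + v))²/(uv). If v = u or v = u⁻¹ it becomes s² with
s = 2 + u + u⁻¹, a root of x² = 7x - 1, which is not a value admitted by projective order at most 5.
-/
theorem eq_sq_or_eq_cube_of_order_five {u v : ℂˣ} {y : ℂ} [Finite (reflGroup u v y)]
    (hy0 : y ≠ 0) (hy' : y + (u - 1) * (v - 1) ≠ 0) (hy : y = -1 - u * v)
    (hu : IsPrimitiveRoot u 5) (hv : IsPrimitiveRoot v 5) : v = u ^ 2 ∨ v = u ^ 3 := by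
  have hu2 : u ^ 2 ≠ 1 := hu.pow_ne_one_of_pos_of_lt (by norm_num) (by norm_num)
  have hv2 : v ^ 2 ≠ 1 := hv.pow_ne_one_of_pos_of_lt (by norm_num) (by norm_num)
  have hmem := mul_mem (reflA_mem u v y) (inv_mem (reflB_mem u v y))
  obtain ⟨e, h1, h5, he⟩ := exists_pow_mem_center_of_sq_ne_one hy0 hy' hu2 hv2 _ hmem
  obtain ⟨x, hx, hxl⟩ := GeneralLinearGroup.pow_mem_center_discr h1 h5 he
  have hBi : ((reflB v y)⁻¹).val = !![1, 0; -(((v⁻¹ : ℂˣ) : ℂ) * y), ((v⁻¹ : ℂˣ) : ℂ)] := rfl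
  have hu0 := u.ne_zero
  have hv0 := v.ne_zero
  have hx' : ((1 + u) * (1 + v) : ℂ) ^ 2 = x * u * v := by
    rw [Units.val_mul, hBi] at hx
    simp [trace_fin_two, det_fin_two, hy] at hx
    field_simp at hx
    linear_combination hx
  have hΦ := coe_fifth_root_relation hu
  have hcontra : ((1 + u) ^ 2 : ℂ) ^ 2 ≠ x * u ^ 2 := by
    intro h
    set s := ((1 + u) ^ 2 / u : ℂ) with hs
    have hxs : x = s ^ 2 := by
      rw [hs]
      field_simp
      linear_combination -h
    have hss : s ^ 2 = 3 * s - 1 := by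
      rw [hs]
      field_simp
      linear_combination hΦ
    have hx7 : x ^ 2 = 7 * x - 1 := by
      rw [hxs]
      linear_combination (s ^ 2 + 3 * s - 1 + 2) * hss
    rcases hxl with rfl | rfl | rfl | rfl | h
    · norm_num at hx7
    · norm_num at hx7
    · norm_num at hx7
    · norm_num at hx7
    · have : x = 0 := by linear_combination h / 4 - hx7 / 4
      norm_num [this] at h
  obtain ⟨k, hk, hkv⟩ := (IsPrimitiveRoot.coe_units_iff.2 hu).eq_pow_of_pow_eq_one
    (IsPrimitiveRoot.coe_units_iff.2 hv).pow_eq_one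
  replace hkv : u ^ k = v := Units.ext (by rw [Units.val_pow_eq_pow_val, hkv])
  interval_cases k
  · exact absurd (by rw [← hkv, pow_zero]) (hv.ne_one (by norm_num))
  · exfalso
    apply hcontra
    rw [pow_one] at hkv
    rw [← hkv] at hx'
    linear_combination hx'
  · exact Or.inl hkv.symm
  · exact Or.inr hkv.symm
  · exfalso
    apply hcontra
    have huv : (u * v : ℂ) = 1 := by
      rw [← Units.val_mul, ← hkv, ← pow_succ', hu.pow_eq_one, Units.val_one]
    linear_combination (u : ℂ) ^ 2 * hx' + (x * u ^ 2 -
      (1 + u) ^ 2 * (1 + u + u + u * v)) * huv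
-- Translation of the parameter conditions and the resulting intersections
theorem mul_eq_mul_of_delta0_eq (hδ : delta0 α β γ₁ γ₂ = -1) : γ₁ * γ₂ = α * β := by
  have h : γ₁ * γ₂ * α⁻¹ * β⁻¹ = 1 := neg_injective hδ
  rw [mul_inv_eq_one, mul_inv_eq_iff_eq_mul] at h
  rw [h, mul_comm]

/-- The left side is tr(AB). Together with det(AB) = α⁻¹β⁻¹ it shows that AB has eigenvalues α⁻¹ and
β⁻¹, so the condition βα⁻¹ = -1 means tr(AB) = 0. -/
theorem trace_offDiag (h : γ₁ * γ₂ = α * β) :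
    1 + offDiag α β + ((γ₁⁻¹ : ℂˣ) : ℂ) * ((γ₂⁻¹ : ℂˣ) : ℂ) = (α : ℂ)⁻¹ + (β : ℂ)⁻¹ := by
  have h1 : ((γ₁⁻¹ : ℂˣ) : ℂ) * ((γ₂⁻¹ : ℂˣ) : ℂ) = (α : ℂ)⁻¹ * (β : ℂ)⁻¹ := by
    rw [← Units.val_mul, ← mul_inv, h, mul_inv, Units.val_mul, Units.val_inv_eq_inv_val,
      Units.val_inv_eq_inv_val]
  rw [h1, offDiag]
  ring

theorem inv_add_inv_eq_zero_iff : (α : ℂ)⁻¹ + (β : ℂ)⁻¹ = 0 ↔ β * α⁻¹ = -1 := by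
  have ha := α.ne_zero
  have hb := β.ne_zero
  rw [Units.ext_iff]
  push_cast
  constructor
  · intro h
    field_simp at h ⊢
    linear_combination h
  · intro h
    field_simp at h ⊢
    linear_combination h

theorem offDiag_add_ne_zero' (h : γ₁ * γ₂ = α * β) (hfin : FiniteIrreducible (Mon α β γ₁ γ₂)) :
    offDiag α β + (((γ₁⁻¹ : ℂˣ) : ℂ) - 1) * (((γ₂⁻¹ : ℂˣ) : ℂ) - 1) ≠ 0 := by
  rw [Units.val_inv_eq_inv_val, Units.val_inv_eq_inv_val]
  exact offDiag_add_ne_zero h hfin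

theorem zpow_mul_zpow_eq_one_of_mem_Ref (h : γ₁ * γ₂ = α * β)
    (hfin : FiniteIrreducible (Mon α β γ₁ γ₂)) {i j : ℤ}
    (hm : M1 γ₁ ^ i * M2 γ₂ ^ j ∈ Ref α β γ₁ γ₂) : γ₁ ^ i * γ₂ ^ j = 1 := by
  have h1 := zpow_eq_one_of_mem_commutator ((M1_zpow_mul_M2_zpow_mem_Ref_iff h hfin i j).1 hm)
  rw [_root_.inv_zpow, _root_.inv_zpow, ← mul_inv, inv_eq_one] at h1
  exact h1

/-- Otherwise A is a nontrivial unipotent matrix, which has infinite order. -/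
theorem gamma1_ne_one (h : γ₁ * γ₂ = α * β) (hfin : FiniteIrreducible (Mon α β γ₁ γ₂)) :
    γ₁ ≠ 1 := by
  rintro rfl
  have := finite_gaussGroup h hfin
  obtain ⟨n, hn, h1⟩ := isOfFinOrder_iff_pow_eq_one.1
    ((gaussGroup α β 1 γ₂).subtype.isOfFinOrder (isOfFinOrder_of_finite (gaussA α β 1 γ₂)))
  have h2 := congrArg (fun g : GL (Fin 2) ℂ => g.val 0 1) h1
  change (reflA (1 : ℂˣ)⁻¹ ^ n).val 0 1 = _ at h2
  rw [reflA_pow] at h2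
  simp at h2
  omega

theorem gamma2_ne_one (h : γ₁ * γ₂ = α * β) (hfin : FiniteIrreducible (Mon α β γ₁ γ₂)) :
    γ₂ ≠ 1 := by
  rintro rfl
  have := finite_gaussGroup h hfin
  obtain ⟨n, hn, h1⟩ := isOfFinOrder_iff_pow_eq_one.1
    ((gaussGroup α β γ₁ 1).subtype.isOfFinOrder (isOfFinOrder_of_finite (gaussB α β γ₁ 1)))
  have h2 := congrArg (fun g : GL (Fin 2) ℂ => g.val 1 0) h1
  change (reflB (1 : ℂˣ)⁻¹ (offDiag α β) ^ n).val 1 0 = _ at h2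
  rw [reflB_pow] at h2
  simp [offDiag_ne_zero h hfin] at h2
  omega

theorem isPrimitiveRoot_of_pow_eq_one {x : ℂˣ} (h1 : x ≠ 1) (h2 : x ≠ -1) {e : ℕ} (he1 : 1 ≤ e)
    (he5 : e ≤ 5) (he : x ^ e = 1) : ∃ q ∈ ({3, 4, 5} : Set ℕ), IsPrimitiveRoot x q := by
  refine ⟨orderOf x, ?_, IsPrimitiveRoot.orderOf x⟩
  have hd : orderOf x ∣ e := orderOf_dvd_of_pow_eq_one he
  have hle := Nat.le_of_dvd he1 hd
  have hpos := Nat.pos_of_dvd_of_pos hd he1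
  have ho1 : orderOf x ≠ 1 := fun h => h1 (orderOf_eq_one_iff.1 h)
  have ho2 : orderOf x ≠ 2 := by
    intro h
    have hx : x ^ 2 = 1 := h ▸ pow_orderOf_eq_one x
    have hx' : (x : ℂ) ^ 2 = 1 := by rw [← Units.val_pow_eq_pow_val, hx, Units.val_one]
    rcases sq_eq_one_iff.1 hx' with h | h
    · exact h1 (Units.ext h)
    · exact h2 (Units.ext h)
  simp only [Set.mem_insert_iff, Set.mem_singleton_iff]
  omega

theorem sq_ne_one_of_ne {x : ℂˣ} (h1 : x ≠ 1) (h2 : x ≠ -1) : x⁻¹ ^ 2 ≠ 1 := by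
  intro h
  rw [inv_pow, inv_eq_one] at h
  have hx' : (x : ℂ) ^ 2 = 1 := by rw [← Units.val_pow_eq_pow_val, h, Units.val_one]
  rcases sq_eq_one_iff.1 hx' with h | h
  · exact h1 (Units.ext h)
  · exact h2 (Units.ext h)

theorem exists_isPrimitiveRoot_gamma1 (h : γ₁ * γ₂ = α * β)
    (hfin : FiniteIrreducible (Mon α β γ₁ γ₂)) (hγ₁ : γ₁ ≠ -1)
    (hall : ∀ g ∈ gaussGroup α β γ₁ γ₂,
      ∃ e, 1 ≤ e ∧ e ≤ 5 ∧ g ^ e ∈ Subgroup.center (GL (Fin 2) ℂ)) :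
    ∃ q ∈ ({3, 4, 5} : Set ℕ), IsPrimitiveRoot γ₁ q := by
  obtain ⟨e, h1, h5, he⟩ := hall _ (reflA_mem _ _ _)
  have := pow_eq_one_of_reflA_pow_mem_center he
  rw [inv_pow, inv_eq_one] at this
  exact isPrimitiveRoot_of_pow_eq_one (gamma1_ne_one h hfin) hγ₁ h1 h5 this

theorem exists_isPrimitiveRoot_gamma2 (h : γ₁ * γ₂ = α * β)
    (hfin : FiniteIrreducible (Mon α β γ₁ γ₂)) (hγ₂ : γ₂ ≠ -1)
    (hall : ∀ g ∈ gaussGroup α β γ₁ γ₂,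
      ∃ e, 1 ≤ e ∧ e ≤ 5 ∧ g ^ e ∈ Subgroup.center (GL (Fin 2) ℂ)) :
    ∃ q ∈ ({3, 4, 5} : Set ℕ), IsPrimitiveRoot γ₂ q := by
  obtain ⟨e, h1, h5, he⟩ := hall _ (reflB_mem _ _ _)
  have := pow_eq_one_of_reflB_pow_mem_center he
  rw [inv_pow, inv_eq_one] at this
  exact isPrimitiveRoot_of_pow_eq_one (gamma2_ne_one h hfin) hγ₂ h1 h5 this

theorem M1_zpow_eq_one (h : γ₁ * γ₂ = α * β) (hfin : FiniteIrreducible (Mon α β γ₁ γ₂)) {n : ℤ}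
    (hn : γ₁ ^ n = 1) : M1 γ₁ ^ n = 1 := by
  obtain ⟨m, rfl | rfl⟩ := n.eq_nat_or_neg
  · rw [zpow_natCast] at hn ⊢
    exact M1_pow_eq_one h hfin (gamma1_ne_one h hfin) hn
  · rw [_root_.zpow_neg, inv_eq_one, zpow_natCast] at hn ⊢
    exact M1_pow_eq_one h hfin (gamma1_ne_one h hfin) hn

theorem M2_zpow_eq_one (h : γ₁ * γ₂ = α * β) (hfin : FiniteIrreducible (Mon α β γ₁ γ₂)) {n : ℤ}
    (hn : γ₂ ^ n = 1) : M2 γ₂ ^ n = 1 := by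
  obtain ⟨m, rfl | rfl⟩ := n.eq_nat_or_neg
  · rw [zpow_natCast] at hn ⊢
    exact M2_pow_eq_one h hfin (gamma2_ne_one h hfin) hn
  · rw [_root_.zpow_neg, inv_eq_one, zpow_natCast] at hn ⊢
    exact M2_pow_eq_one h hfin (gamma2_ne_one h hfin) hn

/-- The determinant condition makes γ₂ʲ trivial as soon as γ₁ⁱ is, and then both matrix powers are
the identity. -/
theorem Ref_inf_Loc_eq_bot (h : γ₁ * γ₂ = α * β) (hfin : FiniteIrreducible (Mon α β γ₁ γ₂))
    (hm : ∀ i j : ℤ, M1 γ₁ ^ i * M2 γ₂ ^ j ∈ Ref α β γ₁ γ₂ → γ₁ ^ i * γ₂ ^ j = 1 → γ₁ ^ i = 1) :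
    Ref α β γ₁ γ₂ ⊓ Loc γ₁ γ₂ = ⊥ := by
  rw [eq_bot_iff]
  rintro g ⟨hR, hL⟩
  obtain ⟨i, j, rfl⟩ := exists_zpow_of_mem_Loc h hfin hL
  have h1 := zpow_mul_zpow_eq_one_of_mem_Ref h hfin hR
  have h2 := hm i j hR h1
  rw [h2, one_mul] at h1
  rw [M1_zpow_eq_one h hfin h2, M2_zpow_eq_one h hfin h1, one_mul]
  exact one_mem _

/-- M₂ fixes e₁₀, whereas M₁ multiplies its own coordinate by γ₁⁻¹. -/
theorem M1_mul_M2_zpow_ne_one {j : ℤ} (h1 : γ₁ ≠ 1) : M1 γ₁ * M2 γ₂ ^ j ≠ 1 := by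
  intro hone
  have hfix : M2 γ₂ • (![0, 1, 0, 0] : Fin 4 → ℂ) = ![0, 1, 0, 0] := by
    ext i
    fin_cases i <;>
      simp [M2, mat2, Units.smul_def, mulVec, dotProduct, Fin.sum_univ_four,
        GeneralLinearGroup.mkOfDetNeZero]
  have hmem : M2 γ₂ ^ j ∈ MulAction.stabilizer (GL (Fin 4) ℂ) (![0, 1, 0, 0] : Fin 4 → ℂ) :=
    zpow_mem (MulAction.mem_stabilizer_iff.2 hfix) j
  have h2 : (M1 γ₁ * M2 γ₂ ^ j) • (![0, 1, 0, 0] : Fin 4 → ℂ) = ![0, 1, 0, 0] := by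
    rw [hone, one_smul]
  rw [mul_smul, MulAction.mem_stabilizer_iff.1 hmem] at h2
  have h3 := congrFun h2 1
  simp [M1, mat1, Units.smul_def, mulVec, dotProduct, Fin.sum_univ_four,
        GeneralLinearGroup.mkOfDetNeZero] at h3
  exact h1 h3

theorem Ref_inf_Loc_eq_zpowers (h : γ₁ * γ₂ = α * β) (hfin : FiniteIrreducible (Mon α β γ₁ γ₂))
    {p : ℕ} (hp : p.Prime) (hp1 : γ₁ ^ p = 1) (hp2 : γ₂ ^ p = 1) {j : ℤ} (hj : γ₁ * γ₂ ^ j = 1)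
    (hm : reflA γ₁⁻¹ * reflB γ₂⁻¹ (offDiag α β) ^ j ∈
      ⁅gaussGroup α β γ₁ γ₂, gaussGroup α β γ₁ γ₂⁆) :
    Ref α β γ₁ γ₂ ⊓ Loc γ₁ γ₂ = Subgroup.zpowers (M1 γ₁ * M2 γ₂ ^ j) ∧
      Nonempty (Subgroup.zpowers (M1 γ₁ * M2 γ₂ ^ j) ≃* Multiplicative (ZMod p)) := by
  have hc := commute_M1_M2 h hfin
  constructor
  · apply le_antisymm
    · rintro g ⟨hR, hL⟩
      obtain ⟨k, l, rfl⟩ := exists_zpow_of_mem_Loc h hfin hL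
      have h1 := zpow_mul_zpow_eq_one_of_mem_Ref h hfin hR
      -- Substituting this into the determinant condition gives γ₂^(l - jk) = 1, so the element is
      -- the k-th power of the generator.
      have hg1 : γ₁ = γ₂ ^ (-j) := by
        rw [_root_.zpow_neg]
        exact eq_inv_of_mul_eq_one_left hj
      rw [hg1, ← _root_.zpow_mul, ← _root_.zpow_add] at h1
      have h2 := M2_zpow_eq_one h hfin h1
      refine Subgroup.mem_zpowers_iff.2 ⟨k, ?_⟩
      rw [(hc.zpow_right j).mul_zpow, ← _root_.zpow_mul]
      congr 1
      rw [_root_.zpow_add] at h2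
      rw [← inv_mul_eq_one, ← _root_.zpow_neg, ← neg_mul, h2]
    · rw [Subgroup.zpowers_le]
      refine ⟨?_, mul_mem M1_mem_Loc (zpow_mem M2_mem_Loc j)⟩
      have := (M1_zpow_mul_M2_zpow_mem_Ref_iff h hfin 1 j).2 (by rwa [_root_.zpow_one])
      rwa [_root_.zpow_one] at this
  · have : Fact p.Prime := ⟨hp⟩
    have ho : orderOf (M1 γ₁ * M2 γ₂ ^ j) = p := by
      refine orderOf_eq_prime ?_ (M1_mul_M2_zpow_ne_one (gamma1_ne_one h hfin))
      rw [(hc.zpow_right j).mul_pow, M1_pow_eq_one h hfin (gamma1_ne_one h hfin) hp1, one_mul,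
        ← zpow_natCast, ← _root_.zpow_mul, mul_comm, _root_.zpow_mul, zpow_natCast,
        M2_pow_eq_one h hfin (gamma2_ne_one h hfin) hp2, _root_.one_zpow]
    have hcard : Nat.card (Subgroup.zpowers (M1 γ₁ * M2 γ₂ ^ j)) = p := by
      rw [Nat.card_zpowers, ho]
    exact ⟨(zmodCyclicMulEquiv (G := Subgroup.zpowers (M1 γ₁ * M2 γ₂ ^ j)) inferInstance).symm.trans
      (AddEquiv.toMultiplicative (ZMod.ringEquivCongr hcard).toAddEquiv)⟩

/-! ### The individual cases -/

theorem Ref_inf_Loc_eq_bot_of_gamma2_eq_neg_one (h : γ₁ * γ₂ = α * β)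
    (hfin : FiniteIrreducible (Mon α β γ₁ γ₂)) (hγ₁ : γ₁ ≠ -1) (hγ₂ : γ₂ = -1)
    (hβα : β * α⁻¹ ≠ -1) : Ref α β γ₁ γ₂ ⊓ Loc γ₁ γ₂ = ⊥ := by
  have := finite_gaussGroup h hfin
  have hy := offDiag_ne_zero h hfin
  have hy' := offDiag_add_ne_zero' h hfin
  have hu2 := sq_ne_one_of_ne (gamma1_ne_one h hfin) hγ₁
  have htr := trace_offDiag h
  have ht : 1 + offDiag α β + ((γ₁⁻¹ : ℂˣ) : ℂ) * ((γ₂⁻¹ : ℂˣ) : ℂ) ≠ 0 := by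
    rw [htr]
    exact fun h => hβα (inv_add_inv_eq_zero_iff.1 h)
  obtain ⟨q, hq, hprim⟩ := exists_isPrimitiveRoot_gamma1 h hfin hγ₁
    (exists_pow_mem_center_of_trace_ne_zero hy hy' hu2 ht)
  apply Ref_inf_Loc_eq_bot h hfin
  intro i j hm hij
  -- γ₁ⁱ is the inverse of a power of -1. For q = 3 or 5 this already makes it trivial; only q = 4
  -- needs the parity obstruction, where i is even and hence j is too.
  have hsq : (γ₁ ^ i) ^ 2 = 1 := by
    have h2 : (γ₂ ^ j) ^ 2 = 1 := by
      rw [← zpow_natCast, ← _root_.zpow_mul, mul_comm, _root_.zpow_mul, hγ₂]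
      simp
    rw [eq_inv_of_mul_eq_one_left hij, inv_pow, h2, inv_one]
  have hqi : (γ₁ ^ i) ^ q = 1 := by
    rw [← zpow_natCast, ← _root_.zpow_mul, mul_comm, _root_.zpow_mul, zpow_natCast,
      hprim.pow_eq_one, _root_.one_zpow]
  simp only [Set.mem_insert_iff, Set.mem_singleton_iff] at hq
  rcases hq with rfl | rfl | rfl
  · rwa [pow_succ, hsq, one_mul] at hqi
  · have hdvd : (4 : ℤ) ∣ i * 2 := by
      have := (hprim.zpow_eq_one_iff_dvd (i * 2)).1 (by
        rw [_root_.zpow_mul]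
        exact_mod_cast hsq)
      exact_mod_cast this
    have hu : ((γ₁⁻¹ : ℂˣ) : ℂ) ^ 2 = -1 := by
      have h4 : (((γ₁⁻¹ : ℂˣ) : ℂ) ^ 2) ^ 2 = 1 := by
        rw [← Units.val_pow_eq_pow_val, ← Units.val_pow_eq_pow_val, ← pow_mul, inv_pow,
          hprim.pow_eq_one, inv_one, Units.val_one]
      rcases sq_eq_one_iff.1 h4 with h | h
      · exact absurd (Units.ext (by rw [Units.val_pow_eq_pow_val, h, Units.val_one])) hu2
      · exact h
    have hv : ((γ₂⁻¹ : ℂˣ) : ℂ) = -1 := by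
      rw [hγ₂]
      simp
    have hsq' := sq_eq_neg_of_order_four hy hy' hu hv ht
    have heven := even_add_of_order_four hu hv hsq' (by rw [hv]; ring)
      ((M1_zpow_mul_M2_zpow_mem_Ref_iff h hfin i j).1 hm)
    have hj : Even j := by
      have hi : Even i := by
        obtain ⟨c, hc⟩ := hdvd
        exact ⟨c, by omega⟩
      exact (Int.even_add.1 heven).1 hi
    rwa [hγ₂, hj.neg_one_zpow, mul_one] at hij
  · rwa [show (5 : ℕ) = 2 + 2 + 1 from rfl, pow_succ, pow_add, hsq, one_mul, one_mul] at hqi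

theorem offDiag_eq_of_trace_eq_zero (h : γ₁ * γ₂ = α * β) (hβα : β * α⁻¹ = -1) :
    offDiag α β = -1 - ((γ₁⁻¹ : ℂˣ) : ℂ) * ((γ₂⁻¹ : ℂˣ) : ℂ) := by
  have h1 := trace_offDiag h
  rw [inv_add_inv_eq_zero_iff.2 hβα] at h1
  linear_combination h1

theorem zpow_pow_eq_one {x : ℂˣ} {q : ℕ} (hx : x ^ q = 1) (i : ℤ) : (x ^ i) ^ q = 1 := by
  rw [← zpow_natCast, ← _root_.zpow_mul, mul_comm, _root_.zpow_mul, zpow_natCast, hx,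
    _root_.one_zpow]

theorem Ref_inf_Loc_eq_bot_of_coprime (h : γ₁ * γ₂ = α * β)
    (hfin : FiniteIrreducible (Mon α β γ₁ γ₂)) {q₁ q₂ : ℕ} (h1 : γ₁ ^ q₁ = 1) (h2 : γ₂ ^ q₂ = 1)
    (hq : q₁.Coprime q₂) : Ref α β γ₁ γ₂ ⊓ Loc γ₁ γ₂ = ⊥ := by
  apply Ref_inf_Loc_eq_bot h hfin
  intro i j _ hij
  have e1 := zpow_pow_eq_one h1 i
  have e2 : (γ₁ ^ i) ^ q₂ = 1 := by
    rw [eq_inv_of_mul_eq_one_left hij, inv_pow, zpow_pow_eq_one h2, inv_one]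
  have := pow_gcd_eq_one.2 ⟨e1, e2⟩
  rwa [hq.gcd_eq_one, pow_one] at this

theorem Ref_inf_Loc_eq_bot_of_cube_root (h : γ₁ * γ₂ = α * β)
    (hfin : FiniteIrreducible (Mon α β γ₁ γ₂)) (hβα : β * α⁻¹ = -1) (h1 : IsPrimitiveRoot γ₁ 3)
    (h2 : γ₂ = γ₁) : Ref α β γ₁ γ₂ ⊓ Loc γ₁ γ₂ = ⊥ := by
  subst h2
  have hrel := coe_cube_root_relation h1.inv
  have hy : offDiag α β = ((γ₂⁻¹ : ℂˣ) : ℂ) := by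
    rw [offDiag_eq_of_trace_eq_zero h hβα]
    linear_combination -hrel
  apply Ref_inf_Loc_eq_bot h hfin
  intro i j hm _
  have hm' := (M1_zpow_mul_M2_zpow_mem_Ref_iff h hfin i j).1 hm
  rw [gaussGroup, hy] at hm'
  have := zpow_eq_one_of_primitive_cube_root hrel hm'
  rwa [_root_.inv_zpow, inv_eq_one] at this

theorem Ref_inf_Loc_of_inverse_cube_root (h : γ₁ * γ₂ = α * β)
    (hfin : FiniteIrreducible (Mon α β γ₁ γ₂)) (hβα : β * α⁻¹ = -1) (h1 : IsPrimitiveRoot γ₁ 3)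
    (h2 : γ₂ = γ₁ ^ 2) : Ref α β γ₁ γ₂ ⊓ Loc γ₁ γ₂ = Subgroup.zpowers (M1 γ₁ * M2 γ₂) ∧
      Nonempty (Subgroup.zpowers (M1 γ₁ * M2 γ₂) ≃* Multiplicative (ZMod 3)) := by
  have hmul : γ₁ * γ₂ = 1 := by rw [h2, ← pow_succ', h1.pow_eq_one]
  have hmul' : γ₁⁻¹ * γ₂⁻¹ = 1 := by rw [← mul_inv, hmul, inv_one]
  have hy : offDiag α β = -2 := by
    rw [offDiag_eq_of_trace_eq_zero h hβα, ← Units.val_mul, hmul', Units.val_one]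
    norm_num
  have hm := mul_mem_commutator_of_cube_root (coe_cube_root_relation h1.inv) hmul' hy
  have := Ref_inf_Loc_eq_zpowers h hfin Nat.prime_three h1.pow_eq_one
    (by rw [h2, ← pow_mul, mul_comm, pow_mul, h1.pow_eq_one, one_pow]) (j := 1)
    (by rw [_root_.zpow_one, hmul]) (by rwa [_root_.zpow_one])
  rwa [_root_.zpow_one] at this

theorem Ref_inf_Loc_of_fifth_roots (h : γ₁ * γ₂ = α * β)
    (hfin : FiniteIrreducible (Mon α β γ₁ γ₂)) (hβα : β * α⁻¹ = -1) (h1 : IsPrimitiveRoot γ₁ 5)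
    (h2 : IsPrimitiveRoot γ₂ 5) {j : ℤ} (hj : γ₁ * γ₂ ^ j = 1) :
    Ref α β γ₁ γ₂ ⊓ Loc γ₁ γ₂ = Subgroup.zpowers (M1 γ₁ * M2 γ₂ ^ j) ∧
      Nonempty (Subgroup.zpowers (M1 γ₁ * M2 γ₂ ^ j) ≃* Multiplicative (ZMod 5)) := by
  have := finite_gaussGroup h hfin
  have hy := offDiag_eq_of_trace_eq_zero h hβα
  have hrel := coe_fifth_root_relation h1.inv
  have hu1 : γ₁⁻¹ ≠ 1 := h1.inv.ne_one (by norm_num)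
  have hv1 : γ₂⁻¹ ≠ 1 := h2.inv.ne_one (by norm_num)
  have hj' : γ₁⁻¹ * γ₂⁻¹ ^ j = 1 := by rw [_root_.inv_zpow, ← mul_inv, hj, inv_one]
  refine Ref_inf_Loc_eq_zpowers h hfin Nat.prime_five h1.pow_eq_one h2.pow_eq_one hj ?_
  rcases eq_sq_or_eq_cube_of_order_five (offDiag_ne_zero h hfin) (offDiag_add_ne_zero' h hfin) hy
    h1.inv h2.inv with hv | hv
  · exact mul_zpow_mem_commutator_of_eq_sq hrel hv1 hv hy hj'
  · exact mul_zpow_mem_commutator_of_eq_cube hrel hu1 hv1 hv hy hj'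

theorem exists_mul_zpow_eq_one {x y : ℂˣ} {q : ℕ} [NeZero q] (hx : IsPrimitiveRoot x q)
    (hy : IsPrimitiveRoot y q) : ∃ j : ℤ, x * y ^ j = 1 := by
  obtain ⟨k, -, hk⟩ := (IsPrimitiveRoot.coe_units_iff.2 hy).eq_pow_of_pow_eq_one
    (IsPrimitiveRoot.coe_units_iff.2 hx.inv).pow_eq_one
  refine ⟨k, ?_⟩
  have : y ^ k = x⁻¹ := Units.ext (by rw [Units.val_pow_eq_pow_val, hk])
  rw [zpow_natCast, this, mul_inv_cancel]

end AppellF4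

theorem mainTheorem6 (α β γ₁ γ₂ : ℂˣ)
    (hfin : AppellF4.FiniteIrreducible (AppellF4.Mon α β γ₁ γ₂))
    (hδ : AppellF4.delta0 α β γ₁ γ₂ = -1) (hγ₁ : γ₁ ≠ -1) :
    (γ₂ = -1 → β * α⁻¹ ≠ -1 →
      AppellF4.Ref α β γ₁ γ₂ ⊓ AppellF4.Loc γ₁ γ₂ = ⊥) ∧
    (β * α⁻¹ = -1 → γ₂ ≠ -1 →
      (∃ q₁ ∈ ({3, 4, 5} : Set ℕ), IsPrimitiveRoot γ₁ q₁) ∧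
      (∃ q₂ ∈ ({3, 4, 5} : Set ℕ), IsPrimitiveRoot γ₂ q₂) ∧
      ∀ q₁ q₂ : ℕ, IsPrimitiveRoot γ₁ q₁ → IsPrimitiveRoot γ₂ q₂ →
        (q₁ ≠ q₂ →
          AppellF4.Ref α β γ₁ γ₂ ⊓ AppellF4.Loc γ₁ γ₂ = ⊥) ∧
        (q₁ = 3 → q₂ = 3 → γ₂ = γ₁ →
          AppellF4.Ref α β γ₁ γ₂ ⊓ AppellF4.Loc γ₁ γ₂ = ⊥) ∧
        (q₁ = 3 → q₂ = 3 → γ₂ = γ₁ ^ 2 →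
          AppellF4.Ref α β γ₁ γ₂ ⊓ AppellF4.Loc γ₁ γ₂ =
            Subgroup.zpowers (AppellF4.M1 γ₁ * AppellF4.M2 γ₂) ∧
          Nonempty (Subgroup.zpowers (AppellF4.M1 γ₁ * AppellF4.M2 γ₂) ≃*
            Multiplicative (ZMod 3))) ∧
        (q₁ = 5 → q₂ = 5 →
          (∃ j : ℤ, γ₁ * γ₂ ^ j = 1) ∧
          ∀ j : ℤ, γ₁ * γ₂ ^ j = 1 →
            AppellF4.Ref α β γ₁ γ₂ ⊓ AppellF4.Loc γ₁ γ₂ =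
              Subgroup.zpowers (AppellF4.M1 γ₁ * AppellF4.M2 γ₂ ^ j) ∧
            Nonempty (Subgroup.zpowers (AppellF4.M1 γ₁ * AppellF4.M2 γ₂ ^ j) ≃*
              Multiplicative (ZMod 5)))) := by
  have h := AppellF4.mul_eq_mul_of_delta0_eq hδ
  refine ⟨AppellF4.Ref_inf_Loc_eq_bot_of_gamma2_eq_neg_one h hfin hγ₁, fun hβα hγ₂ => ?_⟩
  have := AppellF4.finite_gaussGroup h hfin
  have hall := AppellF4.exists_pow_mem_center_of_sq_ne_one (AppellF4.offDiag_ne_zero h hfin)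
    (AppellF4.offDiag_add_ne_zero' h hfin)
    (AppellF4.sq_ne_one_of_ne (AppellF4.gamma1_ne_one h hfin) hγ₁)
    (AppellF4.sq_ne_one_of_ne (AppellF4.gamma2_ne_one h hfin) hγ₂)
  have hex₁ := AppellF4.exists_isPrimitiveRoot_gamma1 h hfin hγ₁ hall
  have hex₂ := AppellF4.exists_isPrimitiveRoot_gamma2 h hfin hγ₂ hall
  refine ⟨hex₁, hex₂, fun q₁ q₂ h1 h2 => ⟨fun hne => ?_, ?_, ?_, ?_⟩⟩
  · obtain ⟨p₁, hp₁, hpr₁⟩ := hex₁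
    obtain ⟨p₂, hp₂, hpr₂⟩ := hex₂
    obtain rfl := hpr₁.unique h1
    obtain rfl := hpr₂.unique h2
    refine AppellF4.Ref_inf_Loc_eq_bot_of_coprime h hfin h1.pow_eq_one h2.pow_eq_one ?_
    simp only [Set.mem_insert_iff, Set.mem_singleton_iff] at hp₁ hp₂
    -- Distinct elements of {3, 4, 5} are coprime.
    rcases hp₁ with rfl | rfl | rfl <;> rcases hp₂ with rfl | rfl | rfl <;>
      first | exact absurd rfl hne | decide
  · rintro rfl rfl hγ
    exact AppellF4.Ref_inf_Loc_eq_bot_of_cube_root h hfin hβα h1 hγ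
  · rintro rfl rfl hγ
    exact AppellF4.Ref_inf_Loc_of_inverse_cube_root h hfin hβα h1 hγ
  · rintro rfl rfl
    exact ⟨AppellF4.exists_mul_zpow_eq_one h1 h2,
      fun j hj => AppellF4.Ref_inf_Loc_of_fifth_roots h hfin hβα h1 h2 hj⟩
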